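/- For $n\ge 2$ let $B_n=\langle\sigma_1,\dots,\sigma_{n-1}\mid \sigma_i\sigma_j=\sigma_j\sigma_i\ (|i-j|\ge 2),\ \sigma_i\sigma_j\sigma_i=\sigma_j\sigma_i\sigma_j\ (|i-j|=1)\rangle$ be the $n$-strand braid group. For $1\le p<q\le n$ put $a_{p,q}=\sigma_p\cdots\sigma_{q-2}\,\sigma_{q-1}\,\sigma_{q-2}^{-1}\cdots\sigma_p^{-1}$, let the dual braid monoid $B_n^{+*}$ be the submonoid of $B_n$ generated by all $a_{p,q}$ with $1\le p<q\le n$, let $\delta_n=\sigma_1\sigma_2\cdots\sigma_{n-1}$, and let $\phi_n$ be the automorphism $\phi_n(\beta)=\delta_n\beta\delta_n^{-1}$. Elements of $B_{n-1}^{+*}$ are regarded as elements of $B_n^{+*}$ through $\sigma_i\mapsto\sigma_i$. For $\beta,\gamma\in B_n^{+*}$, $\gamma$ is a right-divisor of $\beta$ if $\beta=\gamma'\gamma$ for some $\gamma'\in B_n^{+*}$. The $B_{n-1}^{+*}$-tail of $\beta\in B_n^{+*}$ is its maximal right-divisor lying in $B_{n-1}^{+*}$, i.e. the right-divisor of $\beta$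 in $B_{n-1}^{+*}$ of which every right-divisor of $\beta$ lying in $B_{n-1}^{+*}$ is a right-divisor. **Proposition 2.5.** Let $n\ge 3$. For every $\beta\in B_n^{+*}$ with $\beta\ne 1$ there is a unique finite sequence $(\beta_b,\dots,\beta_1)$, $b\ge 1$, of elements of $B_{n-1}^{+*}$ such that $\beta_b\neq 1$, $$\beta=\phi_n^{b-1}(\beta_b)\cdots\phi_n(\beta_2)\,\beta_1,$$ and, for each $k$ with $1\le k\le b$, $\beta_k$ is the $B_{n-1}^{+*}$-tail of $\phi_n^{b-k}(\beta_b)\cdots\phi_n(\beta_{k+1})\,\beta_k$. This sequence is called the $\phi_n$-splitting of $\beta$. Consequently the rotating normal form is well defined. It is given recursively as follows, words being finite sequences of letters $a_{p,q}$: for $\beta\in B_2^{+*}$ it is the word $a_{1,2}^k$ that represents $\beta$; for $m\ge 3$ and $\beta\in B_m^{+*}$ with $\beta\neq1$ it is the word $\phi_m^{b-1}(w_b)\cdots\phi_m(w_2)\,w_1$, where $(\beta_b,\dots,\beta_1)$ is the $\phi_m$-splitting of $\beta$, $w_k$ is the rotating normal form of $\beta_k\in B_{m-1}^{+*}$, and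 $\phi_m$ acts on letters by $a_{p,q}\mapsto a_{p+1,q+1}$ for $q\le m-1$ and $a_{p,m}\mapsto a_{1,p+1}$; for $\beta=1$ it is the empty word. That is, every $\beta\in B_n^{+*}$ has exactly one rotating normal form, and it is a word in the letters $a_{p,q}$, $1\le p<q\le n$, that represents $\beta$. -/

import Mathlib

/-- The indices `1, …, n - 1` of the Artin generators of the `n`-strand braid group. -/
abbrev BraidIndex (n : ℕ) : Type := {i : ℕ // 1 ≤ i ∧ i < n}

/-- Artin's braid relations: `σ_i σ_j = σ_j σ_i` for `|i - j| ≥ 2` and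
`σ_i σ_j σ_i = σ_j σ_i σ_j` for `|i - j| = 1`
(listed for `i < j`; exchanging `i` and `j` gives the same relations). -/
def braidRels (n : ℕ) : Set (FreeGroup (BraidIndex n)) :=
  {r | ∃ i j : BraidIndex n,
    ((i : ℕ) + 2 ≤ j ∧
      r = FreeGroup.of i * FreeGroup.of j * (FreeGroup.of j * FreeGroup.of i)⁻¹) ∨
    ((i : ℕ) + 1 = j ∧
      r = FreeGroup.of i * FreeGroup.of j * FreeGroup.of i *
        (FreeGroup.of j * FreeGroup.of i * FreeGroup.of j)⁻¹)}

/-- Artin's braid group `B_n`. -/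
abbrev BraidGroup (n : ℕ) : Type := PresentedGroup (braidRels n)

/-- The Artin generator `σ_i` of `B_n`, for `1 ≤ i ≤ n - 1` (and `1` for other values of `i`,
which are never used). -/
def artinGen (n i : ℕ) : BraidGroup n :=
  if h : 1 ≤ i ∧ i < n then PresentedGroup.of ⟨i, h⟩ else 1

/-- The product `σ_p σ_{p+1} ⋯ σ_{q-1}` in `B_n` (empty for `q ≤ p`). -/
def artinProd (n p q : ℕ) : BraidGroup n :=
  ((List.range' p (q - p)).map (artinGen n)).prod

/-- The Birman–Ko–Lee generator
`a_{p,q} = σ_p ⋯ σ_{q-2} σ_{q-1} σ_{q-2}⁻¹ ⋯ σ_p⁻¹`, for `1 ≤ p < q ≤ n`. -/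
def bklGen (n p q : ℕ) : BraidGroup n :=
  artinProd n p (q - 1) * artinGen n (q - 1) * (artinProd n p (q - 1))⁻¹

/-- The dual braid monoid `B_n^{+*}`: the submonoid of `B_n` generated by the `a_{p,q}`. -/
def dualBraidMonoid (n : ℕ) : Submonoid (BraidGroup n) :=
  Submonoid.closure {x | ∃ p q : ℕ, 1 ≤ p ∧ p < q ∧ q ≤ n ∧ x = bklGen n p q}

/-- The Garside element `δ_n = σ_1 σ_2 ⋯ σ_{n-1}`. -/
def braidDelta (n : ℕ) : BraidGroup n := artinProd n 1 n

/-- The rotating automorphism `φ_n`, determined by `δ_n β = φ_n(β) δ_n`. -/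
def rotAut (n : ℕ) : MulAut (BraidGroup n) := MulAut.conj (braidDelta n)

theorem artinGen_rels {m n : ℕ} (h : m ≤ n) :
    ∀ r ∈ braidRels m,
      FreeGroup.lift (fun i : BraidIndex m => artinGen n (i : ℕ)) r = 1 := by
  rintro r ⟨⟨i, hi⟩, ⟨j, hj⟩, ⟨hij, rfl⟩ | ⟨hij, rfl⟩⟩
  · have hi' : 1 ≤ i ∧ i < n := ⟨hi.1, by omega⟩
    have hj' : 1 ≤ j ∧ j < n := ⟨hj.1, by omega⟩
    have key := PresentedGroup.one_of_mem (rels := braidRels n)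
      ⟨⟨i, hi'⟩, ⟨j, hj'⟩, Or.inl ⟨hij, rfl⟩⟩
    simp only [map_mul, map_inv, FreeGroup.lift_apply_of] at key ⊢
    simpa [artinGen, hi', hj', PresentedGroup.of] using key
  · have hi' : 1 ≤ i ∧ i < n := ⟨hi.1, by omega⟩
    have hj' : 1 ≤ j ∧ j < n := ⟨hj.1, by omega⟩
    have key := PresentedGroup.one_of_mem (rels := braidRels n)
      ⟨⟨i, hi'⟩, ⟨j, hj'⟩, Or.inr ⟨hij, rfl⟩⟩
    simp only [map_mul, map_inv, FreeGroup.lift_apply_of] at key ⊢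
    simpa [artinGen, hi', hj', PresentedGroup.of] using key

/-- The standard homomorphism `B_{n-1} → B_n`, `σ_i ↦ σ_i` (adding an `n`-th strand on the
right). -/
def braidIncl (n : ℕ) : BraidGroup (n - 1) →* BraidGroup n :=
  PresentedGroup.toGroup (artinGen_rels (Nat.sub_le n 1))

/-- `γ` is a right-divisor of `β` in the monoid `B_n^{+*}`. -/
def IsRightDivisor (n : ℕ) (γ β : BraidGroup n) : Prop :=
  γ ∈ dualBraidMonoid n ∧ ∃ γ' ∈ dualBraidMonoid n, β = γ' * γ

/-- `τ ∈ B_{n-1}^{+*}`, viewed in `B_n`, is the `B_{n-1}^{+*}`-tail of `β`: it is the maximal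
right-divisor of `β` lying in `B_{n-1}^{+*}`, i.e. it is a right-divisor of `β`, and every
right-divisor of `β` lying in `B_{n-1}^{+*}` is a right-divisor of it. -/
def IsTail (n : ℕ) (β : BraidGroup n) (τ : dualBraidMonoid (n - 1)) : Prop :=
  IsRightDivisor n (braidIncl n τ) β ∧
    ∀ γ : dualBraidMonoid (n - 1),
      IsRightDivisor n (braidIncl n γ) β → IsRightDivisor n (braidIncl n γ) (braidIncl n τ)

/-- For a sequence `(β_b, …, β_1)` in `B_{n-1}^{+*}`, written as a list with first entry `β_b`,
the braid `φ_n^{b-1}(β_b) ⋯ φ_n(β_2) β_1` of `B_n`. -/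
def rotProd (n : ℕ) : List (dualBraidMonoid (n - 1)) → BraidGroup n
  | [] => 1
  | x :: s => (rotAut n ^ s.length) (braidIncl n x) * rotProd n s

/-- `s = (β_b, …, β_1)` is a `φ_n`-splitting of `β`: we have `b ≥ 1` and `β_b ≠ 1`,
`β = φ_n^{b-1}(β_b) ⋯ φ_n(β_2) β_1`, and each `β_k` is the `B_{n-1}^{+*}`-tail of
`φ_n^{b-k}(β_b) ⋯ φ_n(β_{k+1}) β_k`
(below, `u = (β_b, …, β_{k+1})`, `x = β_k` and `v = (β_{k-1}, …, β_1)`). -/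
def IsSplitting (n : ℕ) (β : BraidGroup n) (s : List (dualBraidMonoid (n - 1))) : Prop :=
  (∃ h : s ≠ [], s.head h ≠ 1) ∧
  β = rotProd n s ∧
  ∀ (u v : List (dualBraidMonoid (n - 1))) (x : dualBraidMonoid (n - 1)),
    s = u ++ x :: v → IsTail n (rotProd n (u ++ [x])) x

/-- Positive words in the letters `a_{p,q}`; the letter `a_{p,q}` is the pair `(p, q)`. -/
abbrev BKLWord : Type := List (ℕ × ℕ)

/-- `w` is an `n`-strand word: all its letters `a_{p,q}` satisfy `1 ≤ p < q ≤ n`. -/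
def IsBKLWord (n : ℕ) (w : BKLWord) : Prop :=
  ∀ l ∈ w, 1 ≤ l.1 ∧ l.1 < l.2 ∧ l.2 ≤ n

/-- The braid represented by a word. -/
def evalWord (n : ℕ) (w : BKLWord) : BraidGroup n :=
  (w.map fun l => bklGen n l.1 l.2).prod

/-- The action of `φ_n` on letters: `a_{p,q} ↦ a_{p+1,q+1}` for `q ≤ n - 1`, and
`a_{p,n} ↦ a_{1,p+1}`. -/
def rotLetter (n : ℕ) (l : ℕ × ℕ) : ℕ × ℕ :=
  if l.2 < n then (l.1 + 1, l.2 + 1) else (1, l.1 + 1)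

/-- The word `φ_n^{b-1}(w_b) ⋯ φ_n(w_2) w_1` for a list `(w_b, …, w_1)` of words. -/
def rotConcat (n : ℕ) : List BKLWord → BKLWord
  | [] => []
  | w :: ws => w.map ((rotLetter n)^[ws.length]) ++ rotConcat n ws

/-- `w` is a `φ_n`-rotating normal form of `β`. For `n = 2`, `w = a_{1,2}^k` and `w` represents
`β`. For `n ≥ 3`, `w = φ_n^{b-1}(w_b) ⋯ φ_n(w_2) w_1` where `(β_b, …, β_1)` is a `φ_n`-splitting
of `β` and each `w_k` is a `φ_{n-1}`-rotating normal form of `β_k`; if `β = 1`, then `w` is the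
empty word. -/
def IsRotatingNormalForm : (n : ℕ) → BraidGroup n → BKLWord → Prop
  | 0, _, _ => False
  | 1, _, _ => False
  | 2, β, w => ∃ k : ℕ, w = List.replicate k (1, 2) ∧ β = evalWord 2 w
  | n + 3, β, w =>
    (β = 1 ∧ w = []) ∨
    (β ≠ 1 ∧ ∃ (s : List (dualBraidMonoid (n + 2))) (ws : List BKLWord),
      IsSplitting (n + 3) β s ∧
      List.Forall₂ (fun (x : dualBraidMonoid (n + 2)) (u : BKLWord) =>
        IsRotatingNormalForm (n + 2) (x : BraidGroup (n + 2)) u) s ws ∧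
      w = rotConcat (n + 3) ws)

/-!
The main point is that every positive braid `β` has a `B_{n-1}^{+*}`-tail.

*Noncrossing partitions.* A noncrossing partition `r` of `{1, …, n}` has a braid `ncBraid n r`, a
product of generators `a_{i,j}` over consecutive elements of its classes. Cutting a class in two
removes one generator on the left (`ncBraid_cut`), and every refinement is reached by successive
cuts (`exists_le_cut`). Conversely, a positive word for `ncBraid n r` is as short as its
permutation allows, so its letters join elements of the same class of `r` (`rel_of_evalWord_eq`).
Hence the right-divisors of `δ_n` in `B_n^{+*}` are exactly the braids `ncBraid n r`,
right-divisibility is refinement, and greatest common right-divisors of divisors of `δ_n` exist: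
they come from intersections of partitions.

*Garside theory.* Let `M` be a submonoid without nontrivial units of a group, and `δ` a
quasi-central element of `M` whose divisors, the simple elements, have meets, generate `M`, and
present the group by the products among them. For braids this last point holds because the
relations between divisors of `δ_n` imply Artin's relations (`extendsFromSimples`). The monoid
presented by the products of simple elements acts on pairs `(y, a)`, `a` simple, which stand for
`y a` with `a` the greatest simple right-divisor; that the action respects the relations gives
right-cancellation and greatest simple right-divisors (`IsGarside.split_mul_of`,
`IsGarside.right_cancel_of`). As `δ` is quasi-central, the monoid embeds in its localization at
`δ`, and it follows that it is `M` (`IsGarside.eval_injective`).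

*Tails.* The simple elements of `B_{n-1}^{+*}` are those whose partition isolates `n`, so the
greatest simple right-divisor of `β` in `B_{n-1}^{+*}` is a meet with `δ_{n-1}`. By induction on
length, any two right-divisors of `β` in `B_{n-1}^{+*}` have a common left-multiple of the same
kind (`exists_common_multiple`), and a longest one is the tail. The tail is unique because
`B_n^{+*}` has no nontrivial units and `B_{n-1}^{+*}` embeds in `B_n^{+*}` (`braidIncl_injOn`).

*Splitting.* Removing the tail and rotating by `φ_n⁻¹` terminates: each nontrivial tail lowers the
length, and every generator is rotated into `B_{n-1}^{+*}` after at most two steps, since for `n ≥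
3` a chord of the `n`-gon misses a vertex. Uniqueness of the splitting follows from uniqueness of
tails, and the normal form follows by induction on `n`.
-/

namespace DualBraid

/-! ### The Birman–Ko–Lee relations -/

theorem artinGen_commute (n : ℕ) {i j : ℕ} (h : i + 2 ≤ j) :
    Commute (artinGen n i) (artinGen n j) := by
  by_cases hi : 1 ≤ i ∧ i < n
  · by_cases hj : 1 ≤ j ∧ j < n
    · have key := PresentedGroup.one_of_mem (rels := braidRels n)
        ⟨⟨i, hi⟩, ⟨j, hj⟩, Or.inl ⟨h, rfl⟩⟩
      rw [map_mul, map_inv, mul_inv_eq_one, map_mul, map_mul] at key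
      simpa [Commute, SemiconjBy, artinGen, hi, hj, PresentedGroup.of] using key
    · simp [artinGen, hj]
  · simp [artinGen, hi]

theorem artinGen_braid (n : ℕ) {i : ℕ} (h1 : 1 ≤ i) (h2 : i + 1 < n) :
    artinGen n i * artinGen n (i + 1) * artinGen n i =
      artinGen n (i + 1) * artinGen n i * artinGen n (i + 1) := by
  have hi : 1 ≤ i ∧ i < n := ⟨h1, by omega⟩
  have hj : 1 ≤ i + 1 ∧ i + 1 < n := ⟨by omega, h2⟩
  have key := PresentedGroup.one_of_mem (rels := braidRels n)
    ⟨⟨i, hi⟩, ⟨i + 1, hj⟩, Or.inr ⟨rfl, rfl⟩⟩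
  rw [map_mul, map_inv, mul_inv_eq_one] at key
  simp only [map_mul] at key
  simpa [artinGen, hi, h2, PresentedGroup.of] using key

@[simp] theorem artinProd_self (n p : ℕ) : artinProd n p p = 1 := by
  simp [artinProd]

theorem artinProd_of_le (n : ℕ) {p q : ℕ} (h : q ≤ p) : artinProd n p q = 1 := by
  simp [artinProd, Nat.sub_eq_zero_of_le h]

theorem artinProd_succ (n : ℕ) {p q : ℕ} (h : p ≤ q) :
    artinProd n p (q + 1) = artinProd n p q * artinGen n q := by
  rw [artinProd, artinProd, Nat.sub_add_comm h, List.range'_concat]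
  simp [Nat.add_sub_cancel' h]

theorem artinProd_mul (n : ℕ) {p q r : ℕ} (h : p ≤ q) (h' : q ≤ r) :
    artinProd n p q * artinProd n q r = artinProd n p r := by
  induction r, h' using Nat.le_induction with
  | base => simp
  | succ r hr ih => rw [artinProd_succ n hr, artinProd_succ n (h.trans hr), ← ih, mul_assoc]

theorem artinProd_eq_cons (n : ℕ) {p q : ℕ} (h : p < q) :
    artinProd n p q = artinGen n p * artinProd n (p + 1) q := by
  rw [← artinProd_mul n (Nat.le_succ p) h, artinProd_succ n le_rfl, artinProd_self, one_mul]

theorem commute_artinProd (n : ℕ) {x : BraidGroup n} {p q : ℕ}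
    (h : ∀ i, p ≤ i → i < q → Commute x (artinGen n i)) : Commute x (artinProd n p q) := by
  refine Commute.list_prod_right _ _ ?_
  simp only [List.mem_map, List.mem_range'_1]
  rintro _ ⟨i, hi, rfl⟩
  exact h i hi.1 (by omega)

theorem bklGen_succ (n p q : ℕ) :
    bklGen n p (q + 1) = artinProd n p q * artinGen n q * (artinProd n p q)⁻¹ := rfl

@[simp] theorem bklGen_self_succ (n p : ℕ) : bklGen n p (p + 1) = artinGen n p := by
  simp [bklGen_succ]

theorem commute_bklGen (n : ℕ) {x : BraidGroup n} {p q : ℕ} (hpq : p < q)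
    (h : ∀ i, p ≤ i → i < q → Commute x (artinGen n i)) : Commute x (bklGen n p q) := by
  have h1 : Commute x (artinProd n p (q - 1)) :=
    commute_artinProd n fun i hi hq => h i hi (by omega)
  exact (h1.mul_right (h _ (by omega) (by omega))).mul_right h1.inv_right

theorem artinProd_eq_bklGen_mul (n : ℕ) {p q : ℕ} (h : p ≤ q) :
    artinProd n p (q + 1) = bklGen n p (q + 1) * artinProd n p q := by
  rw [bklGen_succ, artinProd_succ n h, inv_mul_cancel_right]

/-- The shift `σ_i ↦ σ_{i+1}` is conjugation by `σ_p ⋯ σ_{q-1}`. -/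
theorem artinProd_mul_artinGen (n : ℕ) {p q i : ℕ} (hp : 1 ≤ p) (hi : p ≤ i) (hiq : i + 1 < q)
    (hq : q ≤ n) :
    artinProd n p q * artinGen n i = artinGen n (i + 1) * artinProd n p q := by
  have e1 : artinProd n p q =
      artinProd n p i * (artinGen n i * artinGen n (i + 1)) * artinProd n (i + 2) q := by
    rw [← artinProd_mul n (q := i) hi (by omega), artinProd_eq_cons n (p := i) (by omega),
      artinProd_eq_cons n (p := i + 1) (by omega)]
    simp only [mul_assoc]
  have c1 : Commute (artinGen n i) (artinProd n (i + 2) q) :=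
    commute_artinProd n fun j hj _ => artinGen_commute n hj
  have c2 : Commute (artinGen n (i + 1)) (artinProd n p i) :=
    commute_artinProd n fun j _ hj => (artinGen_commute n (by omega)).symm
  have hb := artinGen_braid n (i := i) (by omega) (by omega)
  rw [e1]
  calc _ = artinProd n p i * (artinGen n i * artinGen n (i + 1)) *
        (artinProd n (i + 2) q * artinGen n i) := by simp only [mul_assoc]
    _ = artinProd n p i * (artinGen n i * artinGen n (i + 1) * artinGen n i) *
        artinProd n (i + 2) q := by rw [← c1.eq]; simp only [mul_assoc]
    _ = (artinProd n p i * artinGen n (i + 1)) * (artinGen n i * artinGen n (i + 1)) *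
        artinProd n (i + 2) q := by rw [hb]; simp only [mul_assoc]
    _ = _ := by rw [← c2.eq]; simp only [mul_assoc]

theorem artinProd_mul_artinProd (n : ℕ) {p q i j : ℕ} (hp : 1 ≤ p) (hi : p ≤ i) (hjq : j < q)
    (hq : q ≤ n) :
    artinProd n p q * artinProd n i j = artinProd n (i + 1) (j + 1) * artinProd n p q := by
  rcases le_total j i with hij | hij
  · simp [artinProd_of_le n hij, artinProd_of_le n (Nat.succ_le_succ hij)]
  induction j, hij using Nat.le_induction with
  | base => simp
  | succ j hij ih =>
    rw [artinProd_succ n hij, artinProd_succ n (p := i + 1) (by omega), ← mul_assoc,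
      ih (by omega), mul_assoc, artinProd_mul_artinGen n hp (by omega) hjq hq, mul_assoc]

theorem artinProd_mul_bklGen (n : ℕ) {p q i j : ℕ} (hp : 1 ≤ p) (hi : p ≤ i) (hij : i < j)
    (hjq : j < q) (hq : q ≤ n) :
    artinProd n p q * bklGen n i j = bklGen n (i + 1) (j + 1) * artinProd n p q := by
  obtain ⟨j, rfl⟩ : ∃ k, j = k + 1 := ⟨j - 1, by omega⟩
  have h := artinProd_mul_artinProd n (i := i) hp hi (show j < q by omega) hq
  rw [bklGen_succ, bklGen_succ, ← mul_assoc, ← mul_assoc, h, mul_assoc (artinProd n _ _),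
    artinProd_mul_artinGen n hp (by omega) hjq hq]
  rw [← mul_assoc, mul_inv_eq_iff_eq_mul, mul_assoc, mul_assoc, mul_assoc, mul_assoc, h,
    inv_mul_cancel_left]

theorem bklGen_mul_eq_left (n : ℕ) {p q r : ℕ} (hpq : p < q) (hqr : q < r) :
    bklGen n p q * bklGen n q r = bklGen n p r * bklGen n p q := by
  obtain ⟨q, rfl⟩ : ∃ k, q = k + 1 := ⟨q - 1, by omega⟩
  obtain ⟨r, rfl⟩ : ∃ k, r = k + 1 := ⟨r - 1, by omega⟩
  have c : Commute (artinProd n p q) (bklGen n (q + 1) (r + 1)) :=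
    commute_bklGen n hqr fun i hi _ => (commute_artinProd n fun j _ hj =>
      (artinGen_commute n (by omega)).symm).symm
  have e : bklGen n p (r + 1) =
      artinProd n p (q + 1) * bklGen n (q + 1) (r + 1) * (artinProd n p (q + 1))⁻¹ := by
    rw [bklGen_succ, bklGen_succ, ← artinProd_mul n (q := q + 1) (by omega) (by omega : q + 1 ≤ r)]
    group
  rw [e, artinProd_eq_bklGen_mul n (by omega), mul_assoc (bklGen n p (q + 1)), c.eq]
  group

theorem bklGen_mul_artinGen (n : ℕ) {p q : ℕ} (hp : 1 ≤ p) (hpq : p < q) (hq : q < n) :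
    bklGen n p q * artinGen n q = artinGen n q * bklGen n p (q + 1) := by
  obtain ⟨q, rfl⟩ : ∃ k, q = k + 1 := ⟨q - 1, by omega⟩
  have c : Commute (artinGen n (q + 1)) (artinProd n p q) :=
    commute_artinProd n fun j _ hj => (artinGen_commute n (by omega)).symm
  have hb := artinGen_braid n (i := q) (by omega) (by omega)
  rw [bklGen_succ, bklGen_succ, artinProd_succ n (by omega : p ≤ q), mul_inv_rev]
  calc artinProd n p q * artinGen n q * (artinProd n p q)⁻¹ * artinGen n (q + 1)
      = artinProd n p q * (artinGen n q * artinGen n (q + 1) * artinGen n q) *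
          (artinGen n q)⁻¹ * (artinProd n p q)⁻¹ := by
        rw [mul_assoc _ _ (artinGen n (q + 1)), ← c.inv_right.eq]; group
    _ = _ := by
        rw [hb, ← mul_assoc, ← mul_assoc, ← c.eq]; group

theorem bklGen_commute_of_lt (n : ℕ) {p q r s : ℕ} (hpq : p < q) (hqr : q < r) (hrs : r < s) :
    Commute (bklGen n p q) (bklGen n r s) :=
  commute_bklGen n hrs fun _ _ _ => (commute_bklGen n hpq fun _ _ _ =>
    (artinGen_commute n (by omega)).symm).symm

theorem bklGen_mul_eq_right (n : ℕ) {p q r : ℕ} (hp : 1 ≤ p) (hpq : p < q) (hqr : q < r)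
    (hr : r ≤ n) :
    bklGen n p q * bklGen n q r = bklGen n q r * bklGen n p r := by
  induction r, hqr using Nat.le_induction with
  | base => rw [bklGen_self_succ, bklGen_mul_artinGen n hp hpq (by omega)]
  | succ r hqr ih =>
    have e1 := bklGen_mul_artinGen n hp (by omega : p < r) (by omega)
    have e2 := bklGen_mul_artinGen n (by omega) (by omega : q < r) (by omega)
    have c : Commute (bklGen n p q) (artinGen n r) := by
      rw [← bklGen_self_succ]; exact bklGen_commute_of_lt n hpq (by omega) (by omega)
    refine mul_left_cancel (a := artinGen n r) ?_
    rw [← mul_assoc, ← mul_assoc, ← c.eq, ← e2, mul_assoc, ← e2, mul_assoc, ← e1, ← mul_assoc,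
      ih (by omega), mul_assoc]

theorem bklGen_commute_of_nested (n : ℕ) {p q r s : ℕ} (hp : 1 ≤ p) (hpq : p < q) (hqr : q < r)
    (hrs : r < s) (hs : s ≤ n) : Commute (bklGen n q r) (bklGen n p s) := by
  obtain ⟨s, rfl⟩ : ∃ k, s = k + 1 := ⟨s - 1, by omega⟩
  obtain ⟨q, rfl⟩ : ∃ k, q = k + 1 := ⟨q - 1, by omega⟩
  obtain ⟨r, rfl⟩ : ∃ k, r = k + 1 := ⟨r - 1, by omega⟩
  have e := artinProd_mul_bklGen n (q := s) (j := r) hp (by omega : p ≤ q) (by omega) (by omega)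
    (by omega)
  have c : Commute (bklGen n q r) (artinGen n s) := by
    rw [← bklGen_self_succ]; exact bklGen_commute_of_lt n (by omega) (by omega) (by omega)
  rw [eq_mul_inv_iff_mul_eq.mpr e.symm, bklGen_succ n p s]
  exact (Commute.conj_iff _).2 c

theorem bklGen_mul_artinProd (n : ℕ) {p q : ℕ} (hp : 1 ≤ p) (hpq : p < q) (hq : q ≤ n) :
    artinProd n p q = artinProd n (p + 1) q * bklGen n p q := by
  induction q, hpq using Nat.le_induction with
  | base => simp [artinProd_succ]
  | succ q hpq ih =>
    rw [artinProd_succ n (by omega), ih (by omega), mul_assoc,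
      bklGen_mul_artinGen n hp (by omega) (by omega), ← mul_assoc, artinProd_succ n (by omega)]

theorem rotAut_bklGen_of_lt (n : ℕ) {p q : ℕ} (hp : 1 ≤ p) (hpq : p < q) (hq : q < n) :
    rotAut n (bklGen n p q) = bklGen n (p + 1) (q + 1) := by
  rw [rotAut, MulAut.conj_apply, braidDelta, artinProd_mul_bklGen n le_rfl hp hpq hq le_rfl,
    mul_inv_cancel_right]

theorem rotAut_bklGen_last (n : ℕ) {p : ℕ} (hp : 1 ≤ p) (hpn : p < n) :
    rotAut n (bklGen n p n) = bklGen n 1 (p + 1) := by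
  rw [rotAut, MulAut.conj_apply, braidDelta, mul_inv_eq_iff_eq_mul]
  have e1 : artinProd n 1 n = bklGen n 1 (p + 1) * (artinProd n 1 p * artinProd n (p + 1) n) := by
    rw [← mul_assoc, ← artinProd_eq_bklGen_mul n hp, artinProd_mul n (by omega) hpn]
  have e2 : artinProd n 1 p * artinProd n (p + 1) n * bklGen n p n = artinProd n 1 n := by
    rw [mul_assoc, ← bklGen_mul_artinProd n hp hpn le_rfl, artinProd_mul n hp hpn.le]
  conv_lhs => rw [e1]
  rw [mul_assoc, e2]

/-! ### Length and permutation of a braid -/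

/-- The exponent sum of a braid, as a homomorphism to the integers. -/
def lengthHom (n : ℕ) : BraidGroup n →* Multiplicative ℤ :=
  PresentedGroup.toGroup (f := fun _ => Multiplicative.ofAdd 1) (by
    rintro r ⟨i, j, ⟨-, rfl⟩ | ⟨-, rfl⟩⟩ <;> simp)

/-- The exponent sum of a braid. -/
def len (n : ℕ) (x : BraidGroup n) : ℤ := (lengthHom n x).toAdd

@[simp] theorem len_one (n : ℕ) : len n 1 = 0 := by simp [len]

@[simp] theorem len_mul (n : ℕ) (x y : BraidGroup n) : len n (x * y) = len n x + len n y := by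
  simp [len]

@[simp] theorem len_inv (n : ℕ) (x : BraidGroup n) : len n x⁻¹ = - len n x := by simp [len]

theorem len_artinGen (n : ℕ) {i : ℕ} (h1 : 1 ≤ i) (h2 : i < n) : len n (artinGen n i) = 1 := by
  rw [artinGen, dif_pos ⟨h1, h2⟩, len, lengthHom, PresentedGroup.toGroup.of]; rfl

theorem len_bklGen (n : ℕ) {p q : ℕ} (hp : 1 ≤ p) (hpq : p < q) (hq : q ≤ n) :
    len n (bklGen n p q) = 1 := by
  simp [bklGen, len_artinGen n (i := q - 1) (by omega) (by omega)]

theorem len_rotAut (n : ℕ) (x : BraidGroup n) : len n (rotAut n x) = len n x := by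
  simp [rotAut]

theorem len_evalWord (n : ℕ) {w : BKLWord} (hw : IsBKLWord n w) :
    len n (evalWord n w) = w.length := by
  induction w with
  | nil => simp [evalWord]
  | cons l w ih =>
    have hl := hw l (by simp)
    have := ih fun l hl => hw l (by simp [hl])
    simp only [evalWord, List.map_cons, List.prod_cons, len_mul, List.length_cons] at this ⊢
    rw [this, len_bklGen n hl.1 hl.2.1 hl.2.2]; push_cast; ring

/-- The permutation of a braid, with `σ_i` acting on `ℕ` as the transposition of
`i` and `i + 1`. -/
def permHom (n : ℕ) : BraidGroup n →* Equiv.Perm ℕ :=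
  PresentedGroup.toGroup (f := fun i : BraidIndex n => Equiv.swap (i : ℕ) (i + 1)) (by
    rintro r ⟨⟨i, hi⟩, ⟨j, hj⟩, ⟨hij, rfl⟩ | ⟨hij, rfl⟩⟩
    · rw [map_mul, map_inv, mul_inv_eq_one]
      simp only [map_mul, FreeGroup.lift_apply_of]
      dsimp only at hij ⊢
      rw [Equiv.mul_swap_eq_swap_mul, Equiv.swap_apply_of_ne_of_ne (by omega) (by omega),
        Equiv.swap_apply_of_ne_of_ne (by omega) (by omega)]
    · rw [map_mul, map_inv, mul_inv_eq_one]
      simp only [map_mul, FreeGroup.lift_apply_of]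
      dsimp only at hij ⊢
      subst hij
      ext x
      simp only [Equiv.Perm.mul_apply, Equiv.swap_apply_def]
      split_ifs <;> omega)

theorem permHom_artinGen (n : ℕ) {i : ℕ} (h1 : 1 ≤ i) (h2 : i < n) :
    permHom n (artinGen n i) = Equiv.swap i (i + 1) := by
  rw [artinGen, dif_pos ⟨h1, h2⟩, permHom, PresentedGroup.toGroup.of]

theorem permHom_bklGen (n : ℕ) {p q : ℕ} (hp : 1 ≤ p) (hpq : p < q) (hq : q ≤ n) :
    permHom n (bklGen n p q) = Equiv.swap p q := by
  induction q, hpq using Nat.le_induction with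
  | base => rw [bklGen_self_succ, permHom_artinGen n hp (by omega)]
  | succ q hpq ih =>
    have e := congrArg (permHom n) (bklGen_mul_artinGen n hp (by omega : p < q) (by omega))
    rw [map_mul, map_mul, ih (by omega), permHom_artinGen n (by omega) (by omega)] at e
    refine mul_left_cancel (a := Equiv.swap q (q + 1)) ?_
    rw [← e, Equiv.mul_swap_eq_swap_mul _ p (q + 1),
      Equiv.swap_apply_of_ne_of_ne (by omega) (by omega), Equiv.swap_apply_right]

/-! ### The dual braid monoid -/

theorem bklGen_mem (n : ℕ) {p q : ℕ} (hp : 1 ≤ p) (hpq : p < q) (hq : q ≤ n) :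
    bklGen n p q ∈ dualBraidMonoid n :=
  Submonoid.subset_closure ⟨p, q, hp, hpq, hq, rfl⟩

@[simp] theorem evalWord_nil (n : ℕ) : evalWord n [] = 1 := rfl

@[simp] theorem evalWord_cons (n : ℕ) (l : ℕ × ℕ) (w : BKLWord) :
    evalWord n (l :: w) = bklGen n l.1 l.2 * evalWord n w := rfl

@[simp] theorem evalWord_append (n : ℕ) (u w : BKLWord) :
    evalWord n (u ++ w) = evalWord n u * evalWord n w := by
  simp [evalWord]

theorem mem_dualBraidMonoid_iff {n : ℕ} {x : BraidGroup n} :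
    x ∈ dualBraidMonoid n ↔ ∃ w, IsBKLWord n w ∧ evalWord n w = x := by
  constructor
  · intro hx
    induction hx using Submonoid.closure_induction with
    | mem x hx =>
      obtain ⟨p, q, hp, hpq, hq, rfl⟩ := hx
      exact ⟨[(p, q)], by simpa [IsBKLWord] using ⟨hp, hpq, hq⟩, by simp⟩
    | one => exact ⟨[], by simp [IsBKLWord], rfl⟩
    | mul x y _ _ hx hy =>
      obtain ⟨u, hu, rfl⟩ := hx
      obtain ⟨w, hw, rfl⟩ := hy
      exact ⟨u ++ w, fun l hl => (List.mem_append.1 hl).elim (hu l) (hw l), by simp⟩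
  · rintro ⟨w, hw, rfl⟩
    refine Submonoid.list_prod_mem _ ?_
    simp only [List.mem_map]
    rintro _ ⟨l, hl, rfl⟩
    exact bklGen_mem n (hw l hl).1 (hw l hl).2.1 (hw l hl).2.2

theorem len_nonneg {n : ℕ} {x : BraidGroup n} (hx : x ∈ dualBraidMonoid n) : 0 ≤ len n x := by
  obtain ⟨w, hw, rfl⟩ := mem_dualBraidMonoid_iff.1 hx
  rw [len_evalWord n hw]; positivity

theorem eq_one_of_len_eq_zero {n : ℕ} {x : BraidGroup n} (hx : x ∈ dualBraidMonoid n)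
    (h : len n x = 0) : x = 1 := by
  obtain ⟨w, hw, rfl⟩ := mem_dualBraidMonoid_iff.1 hx
  rw [len_evalWord n hw] at h
  have : w = [] := List.length_eq_zero_iff.1 (by exact_mod_cast h)
  rw [this, evalWord_nil]

theorem eq_one_of_inv_mem {n : ℕ} {x : BraidGroup n} (hx : x ∈ dualBraidMonoid n)
    (hx' : x⁻¹ ∈ dualBraidMonoid n) : x = 1 := by
  have h1 := len_nonneg hx
  have h2 := len_nonneg hx'
  rw [len_inv] at h2
  exact eq_one_of_len_eq_zero hx (by omega)

theorem exists_bklGen_mul {n : ℕ} {x : BraidGroup n} (hx : x ∈ dualBraidMonoid n) (h : x ≠ 1) :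
    ∃ p q, 1 ≤ p ∧ p < q ∧ q ≤ n ∧ x * (bklGen n p q)⁻¹ ∈ dualBraidMonoid n := by
  obtain ⟨w, hw, rfl⟩ := mem_dualBraidMonoid_iff.1 hx
  rcases List.eq_nil_or_concat w with rfl | ⟨u, l, rfl⟩
  · simp at h
  · rw [List.concat_eq_append] at hw ⊢
    have hl := hw l (by simp)
    refine ⟨l.1, l.2, hl.1, hl.2.1, hl.2.2, mem_dualBraidMonoid_iff.2 ⟨u, ?_, by simp⟩⟩
    exact fun l hl => hw l (by simp [hl])

theorem rotLetter_spec (n : ℕ) {l : ℕ × ℕ} (h : 1 ≤ l.1 ∧ l.1 < l.2 ∧ l.2 ≤ n) :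
    (1 ≤ (rotLetter n l).1 ∧ (rotLetter n l).1 < (rotLetter n l).2 ∧ (rotLetter n l).2 ≤ n) ∧
      bklGen n (rotLetter n l).1 (rotLetter n l).2 = rotAut n (bklGen n l.1 l.2) := by
  obtain ⟨p, q⟩ := l
  dsimp only at h
  by_cases hq : q < n
  · rw [rotLetter, if_pos hq]
    exact ⟨by dsimp only; omega, (rotAut_bklGen_of_lt n h.1 h.2.1 hq).symm⟩
  · obtain rfl : q = n := by omega
    rw [rotLetter, if_neg hq]
    exact ⟨by dsimp only; omega, (rotAut_bklGen_last q h.1 h.2.1).symm⟩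

theorem rotAut_mem {n : ℕ} {x : BraidGroup n} (hx : x ∈ dualBraidMonoid n) :
    rotAut n x ∈ dualBraidMonoid n := by
  induction hx using Submonoid.closure_induction with
  | mem x hx =>
    obtain ⟨p, q, hp, hpq, hq, rfl⟩ := hx
    obtain ⟨h, e⟩ := rotLetter_spec n (l := (p, q)) ⟨hp, hpq, hq⟩
    rw [← e]; exact bklGen_mem n h.1 h.2.1 h.2.2
  | one => rw [map_one]; exact one_mem _
  | mul x y _ _ hx hy => rw [map_mul]; exact mul_mem hx hy

theorem rotAut_symm_mem {n : ℕ} {x : BraidGroup n} (hx : x ∈ dualBraidMonoid n) :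
    (rotAut n).symm x ∈ dualBraidMonoid n := by
  induction hx using Submonoid.closure_induction with
  | mem x hx =>
    obtain ⟨p, q, hp, hpq, hq, rfl⟩ := hx
    by_cases h1 : p = 1
    · subst h1
      have e := rotAut_bklGen_last n (p := q - 1) (by omega) (by omega)
      rw [Nat.sub_add_cancel (by omega)] at e
      rw [← e, MulEquiv.symm_apply_apply]
      exact bklGen_mem n (by omega) (by omega) le_rfl
    · have e := rotAut_bklGen_of_lt n (p := p - 1) (q := q - 1) (by omega) (by omega) (by omega)
      rw [Nat.sub_add_cancel (by omega), Nat.sub_add_cancel (by omega)] at e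
      rw [← e, MulEquiv.symm_apply_apply]
      exact bklGen_mem n (by omega) (by omega) (by omega)
  | one => rw [map_one]; exact one_mem _
  | mul x y _ _ hx hy => rw [map_mul]; exact mul_mem hx hy

/-! ### Noncrossing partitions and their braids -/

/-- An equivalence relation on `ℕ` is a noncrossing partition of `{1, …, n}` if it is trivial
outside of `{1, …, n}` and no two classes cross. -/
structure IsNoncrossing (n : ℕ) (r : Setoid ℕ) : Prop where
  supp : ∀ i j, r i j → i ≠ j → 1 ≤ i ∧ i ≤ n
  nc : ∀ i j k l, i < j → j < k → k < l → r i k → r j l → r i j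

/-- The generator `a_{i,j}`, or `1` if `i` and `j` do not satisfy `1 ≤ i < j`. -/
def arc (n i j : ℕ) : BraidGroup n := if 1 ≤ i ∧ i < j then bklGen n i j else 1

theorem arc_eq {n i j : ℕ} (h1 : 1 ≤ i) (h2 : i < j) : arc n i j = bklGen n i j :=
  if_pos ⟨h1, h2⟩

@[simp] theorem arc_zero (n j : ℕ) : arc n 0 j = 1 := if_neg (by omega)

theorem arc_mem {n i j : ℕ} (hj : j ≤ n) : arc n i j ∈ dualBraidMonoid n := by
  rw [arc]
  split_ifs with h
  · exact bklGen_mem n h.1 h.2 hj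
  · exact one_mem _

theorem arc_commute {n i j k l : ℕ} (hl : l ≤ n) (h : j < k ∨ (k < i ∧ j < l)) :
    Commute (arc n i j) (arc n k l) := by
  unfold arc
  split_ifs with h1 h2
  · rcases h with h | h
    · exact bklGen_commute_of_lt n h1.2 h h2.2
    · exact bklGen_commute_of_nested n h2.1 h.1 h1.2 h.2 hl
  all_goals simp

theorem arc_mul_left {n p q r : ℕ} (hp : 1 ≤ p) (hpq : p < q) (hqr : q < r) :
    arc n p q * arc n q r = arc n p r * arc n p q := by
  rw [arc_eq hp hpq, arc_eq (by omega) hqr, arc_eq hp (by omega), bklGen_mul_eq_left n hpq hqr]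

theorem arc_mul_right {n p q r : ℕ} (hpq : p < q) (hqr : q < r) (hr : r ≤ n) :
    arc n p q * arc n q r = arc n q r * arc n p r := by
  rcases Nat.eq_zero_or_pos p with rfl | hp
  · simp
  · rw [arc_eq hp hpq, arc_eq (by omega) hqr, arc_eq hp (by omega),
      bklGen_mul_eq_right n hp hpq hqr hr]

open Classical in
/-- The largest element `≤ k` of the class of `q`, or `0` if there is none. -/
noncomputable def lastIn (r : Setoid ℕ) (q k : ℕ) : ℕ := Nat.findGreatest (fun i => r i q) k

/-- The predecessor of `j` in its class, or `0` if `j` is the least element of its class. -/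
noncomputable def pred (r : Setoid ℕ) (j : ℕ) : ℕ := lastIn r j (j - 1)

open Classical in
theorem lastIn_eq_iff {r : Setoid ℕ} {q k m : ℕ} :
    lastIn r q k = m ↔ m ≤ k ∧ (m ≠ 0 → r m q) ∧ ∀ i, m < i → i ≤ k → ¬ r i q :=
  Nat.findGreatest_eq_iff

theorem lastIn_spec (r : Setoid ℕ) (q k : ℕ) :
    lastIn r q k ≤ k ∧ (lastIn r q k ≠ 0 → r (lastIn r q k) q) ∧
      ∀ i, lastIn r q k < i → i ≤ k → ¬ r i q := lastIn_eq_iff.1 rfl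

theorem pred_eq_iff {r : Setoid ℕ} {j m : ℕ} (hj : 1 ≤ j) :
    pred r j = m ↔ m < j ∧ (m ≠ 0 → r m j) ∧ ∀ i, m < i → i < j → ¬ r i j := by
  rw [pred, lastIn_eq_iff]
  refine and_congr (by omega) (and_congr Iff.rfl ⟨fun h i h1 h2 => h i h1 (by omega),
    fun h i h1 h2 => h i h1 (by omega)⟩)

theorem pred_spec (r : Setoid ℕ) {j : ℕ} (hj : 1 ≤ j) :
    pred r j < j ∧ (pred r j ≠ 0 → r (pred r j) j) ∧ ∀ i, pred r j < i → i < j → ¬ r i j :=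
  (pred_eq_iff hj).1 rfl

/-- The product of the generators `a_{i,j}` with `j ≤ k`, in increasing order of `j`, where `i` is
the predecessor of `j` in its class. -/
noncomputable def partialBraid (n : ℕ) (r : Setoid ℕ) : ℕ → BraidGroup n
  | 0 => 1
  | k + 1 => partialBraid n r k * arc n (pred r (k + 1)) (k + 1)

/-- The simple braid of a noncrossing partition: the product of the elements
`a_{i₁,i₂} a_{i₂,i₃} ⋯ a_{i_{m-1},i_m}` over its classes `{i₁ < ⋯ < i_m}`. -/
noncomputable def ncBraid (n : ℕ) (r : Setoid ℕ) : BraidGroup n := partialBraid n r n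

theorem partialBraid_mem {n : ℕ} (r : Setoid ℕ) {k : ℕ} (hk : k ≤ n) :
    partialBraid n r k ∈ dualBraidMonoid n := by
  induction k with
  | zero => exact one_mem _
  | succ k ih => exact mul_mem (ih (by omega)) (arc_mem hk)

theorem ncBraid_mem (n : ℕ) (r : Setoid ℕ) : ncBraid n r ∈ dualBraidMonoid n :=
  partialBraid_mem r le_rfl

/-- The refinement of `r` that divides the class of `p` into its part in the interval `[p, q)` and
the rest. -/
def cut (r : Setoid ℕ) (p q : ℕ) : Setoid ℕ where
  r x y := r x y ∧ (r x p → ((p ≤ x ∧ x < q) ↔ (p ≤ y ∧ y < q)))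
  iseqv :=
    { refl := fun x => ⟨r.refl x, fun _ => Iff.rfl⟩
      symm := fun h => ⟨r.symm h.1, fun hy => (h.2 (r.trans h.1 hy)).symm⟩
      trans := fun h h' => ⟨r.trans h.1 h'.1, fun hx =>
        (h.2 hx).trans (h'.2 (r.trans (r.symm h.1) hx))⟩ }

theorem cut_le (r : Setoid ℕ) (p q : ℕ) : cut r p q ≤ r := fun _ _ h => h.1

theorem IsNoncrossing.cut {n : ℕ} {r : Setoid ℕ} (h : IsNoncrossing n r) (p q : ℕ) :
    IsNoncrossing n (cut r p q) where
  supp i j hij := h.supp i j hij.1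
  nc i j k l hij hjk hkl hik hjl := by
    have hr := h.nc i j k l hij hjk hkl hik.1 hjl.1
    refine ⟨hr, fun hi => ?_⟩
    have h1 := hik.2 hi
    have h2 := hjl.2 (r.trans (r.symm hr) hi)
    omega

theorem pred_cut_of_ne {r : Setoid ℕ} {p q j : ℕ} (hpq : r p q)
    (hj : 1 ≤ j) (hjp : j ≠ p) (hjq : j ≠ q) : pred (cut r p q) j = pred r j := by
  obtain ⟨h1, h2, h3⟩ := pred_spec r hj
  refine (pred_eq_iff hj).2 ⟨h1, fun h0 => ⟨h2 h0, fun hp' => ?_⟩, fun i hi hij hc => ?_⟩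
  · have hjp' : r j p := r.trans (r.symm (h2 h0)) hp'
    -- the class of `p` has no element strictly between `pred r j` and `j`
    have a1 : ¬ (pred r j < p ∧ p < j) := fun hh => h3 p hh.1 hh.2 (r.symm hjp')
    have a2 : ¬ (pred r j < q ∧ q < j) := fun hh =>
      h3 q hh.1 hh.2 (r.trans (r.symm hpq) (r.symm hjp'))
    omega
  · exact h3 i hi hij hc.1

theorem pred_cut_left {r : Setoid ℕ} {p q : ℕ} (hp : 1 ≤ p) (hlt : p < q) :
    pred (cut r p q) p = 0 := by
  refine (pred_eq_iff hp).2 ⟨hp, by simp, fun i _ hi hc => ?_⟩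
  have := hc.2 hc.1
  omega

theorem pred_cut_right {r : Setoid ℕ} {p q : ℕ} (hpq : r p q) (hp : 1 ≤ p) (hlt : p < q) :
    pred (cut r p q) q = pred r p := by
  obtain ⟨h1, h2, h3⟩ := pred_spec r hp
  refine (pred_eq_iff (by omega)).2 ⟨by omega, fun h0 => ⟨r.trans (h2 h0) hpq, fun _ => by omega⟩,
    fun i hi hiq hc => ?_⟩
  have hip : r i p := r.trans hc.1 (r.symm hpq)
  have := hc.2 hip
  exact h3 i hi (by omega) hip

/-- The factorization behind `ncBraid_cut`, following the products up to an index `k` in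
`[p, q)`: the arc that ends in `q` travels to the left through the arcs of the class. -/
theorem partialBraid_mul_arc {n : ℕ} {r : Setoid ℕ} (h : IsNoncrossing n r) {p q : ℕ}
    (hpq : r p q) (hp : 1 ≤ p) (hlt : p < q) (hq : q ≤ n) {k : ℕ} (hk : p ≤ k) (hkq : k < q) :
    partialBraid n r k * arc n (lastIn r q k) q =
      arc n p q * partialBraid n (cut r p q) k * arc n (pred r p) q := by
  have hpp := pred_spec r hp
  have before : ∀ k, k < p → partialBraid n (cut r p q) k = partialBraid n r k ∧
      Commute (partialBraid n r k) (arc n p q) := by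
    intro k hk
    induction k with
    | zero => exact ⟨rfl, Commute.one_left _⟩
    | succ k ih =>
      obtain ⟨e, c⟩ := ih (by omega)
      refine ⟨?_, c.mul_left (arc_commute hq (Or.inl hk))⟩
      rw [partialBraid, partialBraid, e,
        pred_cut_of_ne hpq (by omega) (by omega) (by omega)]
  induction k, hk using Nat.le_induction with
  | base =>
    obtain ⟨p, rfl⟩ : ∃ m, p = m + 1 := ⟨p - 1, by omega⟩
    obtain ⟨e, c⟩ := before p (by omega)
    have hl : lastIn r q (p + 1) = p + 1 :=
      lastIn_eq_iff.2 ⟨le_rfl, fun _ => hpq, fun i h1 h2 => by omega⟩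
    rw [hl, partialBraid, partialBraid, pred_cut_left hp hlt, e, arc_zero, mul_one, mul_assoc,
      arc_mul_right hpp.1 hlt hq, ← mul_assoc, c.eq]
  | succ k hk ih =>
    have ih := ih (by omega)
    obtain ⟨l1, l2, l3⟩ := lastIn_spec r q k
    have hpl : p ≤ lastIn r q k := by
      by_contra hcon
      exact l3 p (by omega) hk hpq
    have hlq : r (lastIn r q k) q := l2 (by omega)
    have epred : pred (cut r p q) (k + 1) = pred r (k + 1) :=
      pred_cut_of_ne hpq (by omega) (by omega) (by omega)
    obtain ⟨k1, k2, k3⟩ := pred_spec r (j := k + 1) (by omega)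
    rw [partialBraid, partialBraid, epred]
    by_cases hkq' : r (k + 1) q
    · have e1 : lastIn r q (k + 1) = k + 1 :=
        lastIn_eq_iff.2 ⟨le_rfl, fun _ => hkq', fun i h1 h2 => by omega⟩
      have e2 : pred r (k + 1) = lastIn r q k := (pred_eq_iff (by omega)).2
        ⟨by omega, fun _ => r.trans hlq (r.symm hkq'), fun i h1 h2 hi =>
          l3 i h1 (by omega) (r.trans hi hkq')⟩
      have c : Commute (arc n (lastIn r q k) (k + 1)) (arc n (pred r p) q) :=
        arc_commute hq (Or.inr ⟨by omega, hkq⟩)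
      rw [e1, e2, mul_assoc, arc_mul_left (by omega) (by omega) hkq, ← mul_assoc, ih,
        mul_assoc _ _ (arc n _ (k + 1)), ← c.eq]
      simp only [mul_assoc]
    · have e1 : lastIn r q (k + 1) = lastIn r q k := lastIn_eq_iff.2
        ⟨by omega, fun _ => hlq, fun i h1 h2 => by
          rcases Nat.lt_or_ge k i with h | h
          · obtain rfl : i = k + 1 := by omega
            exact hkq'
          · exact l3 i h1 h⟩
      -- the arc ending in `k + 1` is nested below the arcs ending in `q`
      have hα : pred r (k + 1) = 0 ∨ lastIn r q k < pred r (k + 1) := by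
        by_contra hcon
        push Not at hcon
        obtain ⟨h0, h1⟩ := hcon
        have hk2 := k2 h0
        rcases h1.lt_or_eq with h1 | h1
        · have := h.nc _ _ _ _ h1 (by omega) hkq hk2 hlq
          exact hkq' (r.trans (r.symm hk2) (r.trans this hlq))
        · rw [h1] at hk2
          exact hkq' (r.trans (r.symm hk2) hlq)
      have c : ∀ i ≤ lastIn r q k, Commute (arc n (pred r (k + 1)) (k + 1)) (arc n i q) := by
        intro i hi
        rcases hα with h0 | h1
        · rw [h0, arc_zero]; exact Commute.one_left _
        · exact arc_commute hq (Or.inr ⟨by omega, hkq⟩)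
      rw [e1, mul_assoc, (c _ le_rfl).eq, ← mul_assoc, ih, mul_assoc, mul_assoc,
        ← (c (pred r p) (by omega)).eq]
      simp only [mul_assoc]

/-- Cutting a class of a noncrossing partition removes a generator on the left of its braid. -/
theorem ncBraid_cut {n : ℕ} {r : Setoid ℕ} (h : IsNoncrossing n r) {p q : ℕ}
    (hpq : r p q) (hlt : p < q) :
    ncBraid n r = bklGen n p q * ncBraid n (cut r p q) := by
  have hp := (h.supp p q hpq (by omega)).1
  have hq := (h.supp q p (r.symm hpq) (by omega)).2
  rw [← arc_eq hp hlt]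
  have key : ∀ k, q ≤ k → partialBraid n r k = arc n p q * partialBraid n (cut r p q) k := by
    intro k hk
    induction k, hk using Nat.le_induction with
    | base =>
      obtain ⟨q, rfl⟩ : ∃ m, q = m + 1 := ⟨q - 1, by omega⟩
      have := partialBraid_mul_arc h hpq hp hlt hq (k := q) (by omega) (by omega)
      rw [partialBraid, partialBraid, pred_cut_right hpq hp hlt, ← mul_assoc, ← this]
      rfl
    | succ k hk ih =>
      rw [partialBraid, partialBraid, pred_cut_of_ne hpq (by omega) (by omega) (by omega),
        ih, mul_assoc]
  exact key n hq

/-- A proper refinement of a noncrossing partition factors through a cut. -/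
theorem exists_le_cut {n : ℕ} {r s : Setoid ℕ} (hs : IsNoncrossing n s) (hle : s ≤ r)
    (hne : s ≠ r) : ∃ p q, p < q ∧ r p q ∧ s ≤ cut r p q := by
  classical
  obtain ⟨x₀, y₀, hr₀, hs₀⟩ : ∃ x y, r x y ∧ ¬ s x y := by
    by_contra hcon
    push Not at hcon
    exact hne (le_antisymm hle fun {x y} h => hcon x y h)
  have hB : ∃ m, r m x₀ := ⟨x₀, r.refl _⟩
  -- `m` is the least element of a class of `r` that is divided by `s`
  obtain ⟨m, hm, hmin⟩ : ∃ m, r m x₀ ∧ ∀ i, r i x₀ → m ≤ i :=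
    ⟨Nat.find hB, Nat.find_spec hB, fun i hi => Nat.find_min' hB hi⟩
  have hX : ∃ x, r x x₀ ∧ ¬ s x m := by
    by_contra hcon
    push Not at hcon
    exact hs₀ (s.trans (hcon x₀ (r.refl _)) (s.symm (hcon y₀ (r.symm hr₀))))
  -- `x` is the least element of that class which `s` separates from `m`
  obtain ⟨x, ⟨hx, hxm⟩, hxmin⟩ : ∃ x, (r x x₀ ∧ ¬ s x m) ∧ ∀ i, r i x₀ → i < x → s i m :=
    ⟨Nat.find hX, Nat.find_spec hX, fun i hi hlt => by
      have := Nat.find_min hX hlt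
      push Not at this
      exact this hi⟩
  have hmx : m < x := lt_of_le_of_ne (hmin x hx) fun e => hxm (e ▸ s.refl _)
  by_cases hY : ∃ y, x < y ∧ s y m
  · -- the part of the class from `x` to the next element related to `m` is cut out
    obtain ⟨y, ⟨hxy, hym⟩, hymin⟩ : ∃ y, (x < y ∧ s y m) ∧ ∀ i, x < i → i < y → ¬ s i m :=
      ⟨Nat.find hY, Nat.find_spec hY, fun i hi hlt h => Nat.find_min hY hlt ⟨hi, h⟩⟩
    have hyx : r y x₀ := r.trans (hle hym) hm
    refine ⟨x, y, hxy, r.trans hx (r.symm hyx), ?_⟩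
    have key : ∀ a b, s a b → r a x → x ≤ a ∧ a < y → x ≤ b ∧ b < y := by
      intro a b hab hax ha
      have ham : ¬ s a m := by
        rcases ha.1.eq_or_lt with h | h
        · rw [← h]; exact hxm
        · exact hymin a h ha.2
      have hbm : ¬ s b m := fun h => ham (s.trans hab h)
      refine ⟨?_, ?_⟩
      · by_contra hcon
        exact hbm (hxmin b (r.trans (r.symm (hle hab)) (r.trans hax hx)) (by omega))
      · by_contra hcon
        rcases (not_lt.1 hcon).eq_or_lt with h | h
        · exact hbm (h ▸ hym)
        · exact ham (s.symm (hs.nc m a y b (by omega) ha.2 h (s.symm hym) hab))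
    intro a b hab
    exact ⟨hle hab, fun ha => ⟨key a b hab ha,
      key b a (s.symm hab) (r.trans (r.symm (hle hab)) ha)⟩⟩
  · -- the class of `m` under `s` is an initial part of the class under `r`
    push Not at hY
    refine ⟨m, x, hmx, r.trans hm (r.symm hx), ?_⟩
    have key : ∀ a b, s a b → r a m → m ≤ a ∧ a < x → m ≤ b ∧ b < x := by
      intro a b hab ham ha
      have hsm : s b m := s.trans (s.symm hab) (hxmin a (r.trans ham hm) ha.2)
      refine ⟨hmin b (r.trans (hle hsm) hm), ?_⟩
      by_contra hcon
      rcases (not_lt.1 hcon).eq_or_lt with h | h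
      · exact hxm (h ▸ hsm)
      · exact hY b h hsm
    intro a b hab
    exact ⟨hle hab, fun ha => ⟨key a b hab ha,
      key b a (s.symm hab) (r.trans (r.symm (hle hab)) ha)⟩⟩

/-- Refinement implies right-divisibility of the braids. -/
theorem ncBraid_dvd_of_le {n : ℕ} {r s : Setoid ℕ} (hr : IsNoncrossing n r)
    (hs : IsNoncrossing n s) (hle : s ≤ r) :
    ncBraid n r * (ncBraid n s)⁻¹ ∈ dualBraidMonoid n := by
  obtain ⟨k, hk⟩ : ∃ k : ℕ, len n (ncBraid n r) = k :=
    ⟨_, (Int.toNat_of_nonneg (len_nonneg (ncBraid_mem n r))).symm⟩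
  induction k generalizing r with
  | zero =>
    by_cases hne : s = r
    · rw [hne, mul_inv_cancel]; exact one_mem _
    · obtain ⟨p, q, hlt, hpq, -⟩ := exists_le_cut hs hle hne
      have hp := (hr.supp p q hpq (by omega)).1
      have hq := (hr.supp q p (r.symm hpq) (by omega)).2
      rw [ncBraid_cut hr hpq hlt, len_mul, len_bklGen n hp hlt hq] at hk
      have := len_nonneg (ncBraid_mem n (cut r p q))
      push_cast at hk; omega
  | succ k ih =>
    by_cases hne : s = r
    · rw [hne, mul_inv_cancel]; exact one_mem _
    · obtain ⟨p, q, hlt, hpq, hc⟩ := exists_le_cut hs hle hne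
      have hp := (hr.supp p q hpq (by omega)).1
      have hq := (hr.supp q p (r.symm hpq) (by omega)).2
      rw [ncBraid_cut hr hpq hlt] at hk ⊢
      rw [len_mul, len_bklGen n hp hlt hq] at hk
      rw [mul_assoc]
      exact mul_mem (bklGen_mem n hp hlt hq) (ih (hr.cut p q) hc (by push_cast at hk; omega))

/-! ### Permutations detect the divisors of simple braids -/

open Classical in
/-- The elements of `{1, …, k}` that are not least in their class. -/
noncomputable def nonMin (r : Setoid ℕ) (k : ℕ) : Finset ℕ :=
  (Finset.Icc 1 k).filter fun j => pred r j ≠ 0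

theorem mem_nonMin {r : Setoid ℕ} {k j : ℕ} :
    j ∈ nonMin r k ↔ (1 ≤ j ∧ j ≤ k) ∧ pred r j ≠ 0 := by
  simp [nonMin]

theorem len_partialBraid {n : ℕ} (r : Setoid ℕ) {k : ℕ} (hk : k ≤ n) :
    len n (partialBraid n r k) = (nonMin r k).card := by
  classical
  induction k with
  | zero => simp [partialBraid, nonMin]
  | succ k ih =>
    obtain ⟨h1, -⟩ := pred_spec r (j := k + 1) (by omega)
    rw [partialBraid, len_mul, ih (by omega)]
    by_cases h0 : pred r (k + 1) = 0
    · have : nonMin r (k + 1) = nonMin r k := by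
        ext j
        simp only [mem_nonMin]
        refine ⟨fun h => ⟨⟨h.1.1, ?_⟩, h.2⟩, fun h => ⟨⟨h.1.1, by omega⟩, h.2⟩⟩
        by_contra hcon
        obtain rfl : j = k + 1 := by omega
        exact h.2 h0
      rw [h0, arc_zero, len_one, this, add_zero]
    · have : nonMin r (k + 1) = insert (k + 1) (nonMin r k) := by
        ext j
        simp only [mem_nonMin, Finset.mem_insert]
        constructor
        · intro h
          rcases Nat.lt_or_ge k j with hj | hj
          · left; omega
          · exact Or.inr ⟨⟨h.1.1, hj⟩, h.2⟩
        · rintro (rfl | h)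
          · exact ⟨⟨by omega, le_rfl⟩, h0⟩
          · exact ⟨⟨h.1.1, by omega⟩, h.2⟩
      rw [this, Finset.card_insert_of_notMem (by simp [mem_nonMin]),
        arc_eq (by omega) h1, len_bklGen n (by omega) h1 hk]
      push_cast; rfl

/-- The permutation of the braid of a partition maps each element to the next one in its
class. -/
theorem permHom_partialBraid {n : ℕ} (r : Setoid ℕ) {k : ℕ} (hk : k ≤ n) :
    (∀ x, k < x → permHom n (partialBraid n r k) x = x) ∧
      ∀ j ∈ nonMin r k, permHom n (partialBraid n r k) (pred r j) = j := by
  induction k with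
  | zero => exact ⟨fun x _ => by simp [partialBraid], fun j hj => by simp [nonMin] at hj⟩
  | succ k ih =>
    obtain ⟨ih1, ih2⟩ := ih (by omega)
    obtain ⟨h1, h2, h3⟩ := pred_spec r (j := k + 1) (by omega)
    by_cases h0 : pred r (k + 1) = 0
    · rw [partialBraid, h0, arc_zero, mul_one]
      refine ⟨fun x hx => ih1 x (by omega), fun j hj => ih2 j ?_⟩
      rw [mem_nonMin] at hj ⊢
      refine ⟨⟨hj.1.1, ?_⟩, hj.2⟩
      by_contra hcon
      obtain rfl : j = k + 1 := by omega
      exact hj.2 h0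
    · rw [partialBraid, arc_eq (by omega) h1, map_mul, permHom_bklGen n (by omega) h1 hk]
      refine ⟨fun x hx => ?_, fun j hj => ?_⟩
      · rw [Equiv.Perm.mul_apply, Equiv.swap_apply_of_ne_of_ne (by omega) (by omega),
          ih1 x (by omega)]
      · rw [mem_nonMin] at hj
        rw [Equiv.Perm.mul_apply]
        rcases hj.1.2.eq_or_lt with rfl | hlt
        · rw [Equiv.swap_apply_left, ih1 _ (by omega)]
        · obtain ⟨j1, j2, j3⟩ := pred_spec r (j := j) hj.1.1
          have hne : pred r j ≠ pred r (k + 1) := by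
            intro e
            refine h3 j (by omega) hlt (r.trans (r.symm (j2 hj.2)) ?_)
            rw [e]; exact h2 h0
          rw [Equiv.swap_apply_of_ne_of_ne hne (by omega)]
          exact ih2 j (mem_nonMin.2 ⟨⟨hj.1.1, by omega⟩, hj.2⟩)

/-- The span of the vectors `e_p - e_q`, for the letters `a_{p,q}` of a word. -/
noncomputable def wordSpan (w : BKLWord) : Submodule ℚ (ℕ →₀ ℚ) :=
  Submodule.span ℚ ((fun l : ℕ × ℕ => Finsupp.single l.1 1 - Finsupp.single l.2 1) '' {l | l ∈ w})

theorem finrank_wordSpan_le (w : BKLWord) : Module.finrank ℚ (wordSpan w) ≤ w.length := by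
  classical
  have : wordSpan w = Submodule.span ℚ ((w.toFinset.image fun l : ℕ × ℕ =>
      (Finsupp.single l.1 1 - Finsupp.single l.2 1 : ℕ →₀ ℚ) : Finset (ℕ →₀ ℚ)) :
        Set (ℕ →₀ ℚ)) := by
    rw [wordSpan]; congr 1; ext; simp
  rw [this]
  exact (finrank_span_finset_le_card _).trans
    (Finset.card_image_le.trans (List.toFinset_card_le w))

instance (w : BKLWord) : FiniteDimensional ℚ (wordSpan w) :=
  FiniteDimensional.span_of_finite ℚ ((List.finite_toSet w).image _)

theorem wordSpan_mono {u w : BKLWord} (h : ∀ l ∈ u, l ∈ w) : wordSpan u ≤ wordSpan w :=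
  Submodule.span_mono (Set.image_mono h)

/-- The permutation of a word moves each basis vector within a coset of the span of the word. -/
theorem single_sub_mem_wordSpan {n : ℕ} {w : BKLWord} (hw : IsBKLWord n w) (x : ℕ) :
    (Finsupp.single (permHom n (evalWord n w) x) 1 - Finsupp.single x 1 : ℕ →₀ ℚ) ∈
      wordSpan w := by
  induction w with
  | nil => simp
  | cons l w ih =>
    have hl := hw l (by simp)
    have ih := wordSpan_mono (w := l :: w) (fun l' h => by simp [h])
      (ih fun l h => hw l (by simp [h]))
    rw [evalWord_cons, map_mul, Equiv.Perm.mul_apply, permHom_bklGen n hl.1 hl.2.1 hl.2.2]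
    generalize permHom n (evalWord n w) x = y at ih ⊢
    have hmem : (Finsupp.single l.1 1 - Finsupp.single l.2 1 : ℕ →₀ ℚ) ∈ wordSpan (l :: w) :=
      Submodule.subset_span ⟨l, by simp, rfl⟩
    have hstep : (Finsupp.single (Equiv.swap l.1 l.2 y) 1 - Finsupp.single y 1 : ℕ →₀ ℚ) ∈
        wordSpan (l :: w) := by
      rcases eq_or_ne y l.1 with rfl | h1
      · rw [Equiv.swap_apply_left]
        simpa using neg_mem hmem
      · rcases eq_or_ne y l.2 with rfl | h2
        · rw [Equiv.swap_apply_right]; exact hmem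
        · rw [Equiv.swap_apply_of_ne_of_ne h1 h2, sub_self]; exact zero_mem _
    simpa using add_mem hstep ih

open Classical in
/-- The sum of the coordinates indexed by the elements `≥ j` of the class of `j`. -/
noncomputable def tailSum (r : Setoid ℕ) (j : ℕ) : Module.Dual ℚ (ℕ →₀ ℚ) :=
  Finsupp.linearCombination ℚ fun x => if r x j ∧ j ≤ x then (1 : ℚ) else 0

open Classical in
theorem tailSum_single (r : Setoid ℕ) (j x : ℕ) :
    tailSum r j (Finsupp.single x 1) = if r x j ∧ j ≤ x then (1 : ℚ) else 0 := by
  simp [tailSum]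

/-- The vectors `e_j - e_{pred j}` are independent, because the functionals `tailSum r j` are dual
to them. -/
theorem linearIndependent_nonMin (r : Setoid ℕ) (k : ℕ) :
    LinearIndependent ℚ fun j : nonMin r k =>
      (Finsupp.single (j : ℕ) 1 - Finsupp.single (pred r j) 1 : ℕ →₀ ℚ) := by
  classical
  refine LinearIndependent.of_pairwise_dual_eq_zero_one _ (fun j => tailSum r j) ?_ ?_
  · rintro ⟨i, hi⟩ ⟨j, hj⟩ hij
    have hij : i ≠ j := fun e => hij (Subtype.ext e)
    rw [mem_nonMin] at hj
    obtain ⟨j1, j2, j3⟩ := pred_spec r (j := j) hj.1.1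
    have hj2 := j2 hj.2
    rw [map_sub, tailSum_single, tailSum_single, sub_eq_zero]
    dsimp only
    refine if_congr ⟨fun h => ⟨r.trans hj2 h.1, ?_⟩, fun h => ⟨r.trans (r.symm hj2) h.1,
      by omega⟩⟩ rfl rfl
    by_contra hcon
    exact j3 i (by omega) (by omega) (r.symm h.1)
  · rintro ⟨j, hj⟩
    rw [mem_nonMin] at hj
    obtain ⟨j1, j2, j3⟩ := pred_spec r (j := j) hj.1.1
    rw [map_sub, tailSum_single, tailSum_single]
    dsimp only
    rw [if_pos ⟨r.refl j, le_rfl⟩, if_neg (by omega), sub_zero]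

/-- Every letter of a positive word that represents the braid of a noncrossing partition joins two
elements of the same class.  The word is as short as its permutation allows, so that the vectors
`e_p - e_q` of its letters span no more than those of the partition. -/
theorem rel_of_evalWord_eq {n : ℕ} {r : Setoid ℕ} {w : BKLWord} (hw : IsBKLWord n w)
    (h : evalWord n w = ncBraid n r) : ∀ l ∈ w, r l.1 l.2 := by
  classical
  let v : nonMin r n → (ℕ →₀ ℚ) := fun j => Finsupp.single (j : ℕ) 1 - Finsupp.single (pred r j) 1
  have hle : Submodule.span ℚ (Set.range v) ≤ wordSpan w := by
    rw [Submodule.span_le]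
    rintro _ ⟨⟨j, hj⟩, rfl⟩
    have := single_sub_mem_wordSpan hw (pred r j)
    rw [h, ncBraid, (permHom_partialBraid r le_rfl).2 j hj] at this
    exact this
  have hcard : w.length = (nonMin r n).card := by
    have := len_evalWord n hw
    rw [h, ncBraid, len_partialBraid r le_rfl] at this
    exact_mod_cast this.symm
  have heq : Submodule.span ℚ (Set.range v) = wordSpan w := by
    refine Submodule.eq_of_le_of_finrank_le hle ?_
    rw [finrank_span_eq_card (linearIndependent_nonMin r n), Fintype.card_coe, ← hcard]
    exact finrank_wordSpan_le w
  intro l hl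
  -- the sum of the coordinates in the class of `l.1` vanishes on the span
  let φ : Module.Dual ℚ (ℕ →₀ ℚ) :=
    Finsupp.linearCombination ℚ fun x => if r x l.1 then (1 : ℚ) else 0
  have hφ : Submodule.span ℚ (Set.range v) ≤ LinearMap.ker φ := by
    rw [Submodule.span_le]
    rintro _ ⟨⟨j, hj⟩, rfl⟩
    rw [mem_nonMin] at hj
    have hj2 := (pred_spec r (j := j) hj.1.1).2.1 hj.2
    have : r j l.1 ↔ r (pred r j) l.1 :=
      ⟨fun h => r.trans hj2 h, fun h => r.trans (r.symm hj2) h⟩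
    simp [φ, v, this]
  have hmem : (Finsupp.single l.1 1 - Finsupp.single l.2 1 : ℕ →₀ ℚ) ∈ wordSpan w :=
    Submodule.subset_span ⟨l, hl, rfl⟩
  rw [← heq] at hmem
  have := hφ hmem
  by_contra hcon
  have hcon' : ¬ r l.2 l.1 := fun h => hcon (r.symm h)
  simp [φ, hcon'] at this

/-- If a product `x y` of positive braids is the braid of `r`, then `x` and `y` are represented by
words whose letters join elements of the same class. -/
theorem rel_of_mul_eq {n : ℕ} {r : Setoid ℕ} {x y : BraidGroup n} (hx : x ∈ dualBraidMonoid n)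
    (hy : y ∈ dualBraidMonoid n) (h : x * y = ncBraid n r) :
    (∃ w, IsBKLWord n w ∧ evalWord n w = x ∧ ∀ l ∈ w, r l.1 l.2) ∧
      ∃ w, IsBKLWord n w ∧ evalWord n w = y ∧ ∀ l ∈ w, r l.1 l.2 := by
  obtain ⟨u, hu, rfl⟩ := mem_dualBraidMonoid_iff.1 hx
  obtain ⟨w, hw, rfl⟩ := mem_dualBraidMonoid_iff.1 hy
  rw [← evalWord_append] at h
  have := rel_of_evalWord_eq (fun l hl => (List.mem_append.1 hl).elim (hu l) (hw l)) h
  exact ⟨⟨u, hu, rfl, fun l hl => this l (by simp [hl])⟩,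
    ⟨w, hw, rfl, fun l hl => this l (by simp [hl])⟩⟩

/-- Every right-divisor of the braid of a noncrossing partition is the braid of a refinement. -/
theorem exists_ncBraid_eq {n : ℕ} {r : Setoid ℕ} (hr : IsNoncrossing n r) {x y : BraidGroup n}
    (hx : x ∈ dualBraidMonoid n) (hy : y ∈ dualBraidMonoid n) (h : x * y = ncBraid n r) :
    ∃ s, IsNoncrossing n s ∧ s ≤ r ∧ y = ncBraid n s := by
  obtain ⟨w, hw, rfl⟩ := mem_dualBraidMonoid_iff.1 hx
  induction w generalizing r with
  | nil => exact ⟨r, hr, le_rfl, by simpa using h⟩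
  | cons l w ih =>
    have hl := hw l (by simp)
    have hw' : IsBKLWord n w := fun l h => hw l (by simp [h])
    obtain ⟨u, hu, rfl⟩ := mem_dualBraidMonoid_iff.1 hy
    have hrel : r l.1 l.2 := by
      rw [← evalWord_append] at h
      exact rel_of_evalWord_eq (fun l hl => (List.mem_append.1 hl).elim (hw l) (hu l)) h l
        (by simp)
    rw [ncBraid_cut hr hrel hl.2.1, evalWord_cons, mul_assoc] at h
    obtain ⟨s, hs, hle, e⟩ := ih (hr.cut _ _) hw'
      (mem_dualBraidMonoid_iff.2 ⟨w, hw', rfl⟩) (mul_left_cancel h)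
    exact ⟨s, hs, hle.trans (cut_le _ _ _), e⟩

/-- Right-divisibility of the braids implies refinement. -/
theorem le_of_ncBraid_dvd {n : ℕ} {r s : Setoid ℕ} (hs : IsNoncrossing n s)
    (h : ncBraid n r * (ncBraid n s)⁻¹ ∈ dualBraidMonoid n) : s ≤ r := by
  have key : ∀ p q, p < q → s p q → r p q := by
    intro p q hlt hpq
    have hp := (hs.supp p q hpq (by omega)).1
    have hq := (hs.supp q p (s.symm hpq) (by omega)).2
    obtain ⟨u, hu, eu⟩ := mem_dualBraidMonoid_iff.1 h
    obtain ⟨w, hw, ew⟩ := mem_dualBraidMonoid_iff.1 (ncBraid_mem n (cut s p q))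
    have e : evalWord n (u ++ (p, q) :: w) = ncBraid n r := by
      rw [evalWord_append, evalWord_cons, ew, eu, ← ncBraid_cut hs hpq hlt, inv_mul_cancel_right]
    refine rel_of_evalWord_eq ?_ e (p, q) (by simp)
    intro l hl
    rcases List.mem_append.1 hl with hl | hl
    · exact hu l hl
    · rcases List.mem_cons.1 hl with rfl | hl
      · exact ⟨hp, hlt, hq⟩
      · exact hw l hl
  intro p q hpq
  rcases lt_trichotomy p q with hlt | rfl | hlt
  · exact key p q hlt hpq
  · exact r.refl p
  · exact r.symm (key q p hlt (s.symm hpq))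

theorem ncBraid_injective {n : ℕ} {r s : Setoid ℕ} (hr : IsNoncrossing n r)
    (hs : IsNoncrossing n s) (h : ncBraid n r = ncBraid n s) : r = s :=
  le_antisymm (le_of_ncBraid_dvd hr (by rw [h, mul_inv_cancel]; exact one_mem _))
    (le_of_ncBraid_dvd hs (by rw [h, mul_inv_cancel]; exact one_mem _))

/-! ### Garside elements with meets -/

/-- `s` is a simple element of the submonoid `M` with respect to `δ`: both `s` and its
left complement `δ s⁻¹` lie in `M`, i.e. `s` is a right-divisor of `δ` in `M`. -/
def IsSimple {G : Type*} [Group G] (M : Submonoid G) (δ s : G) : Prop :=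
  s ∈ M ∧ δ * s⁻¹ ∈ M

/-- `δ` is a Garside element of the submonoid `M` of a group: `M` has no nontrivial units,
conjugation by `δ` preserves `M`, and any two simple elements have a greatest common
right-divisor.  That `x` right-divides `y` is written `y * x⁻¹ ∈ M`. -/
structure IsGarside {G : Type*} [Group G] (M : Submonoid G) (δ : G) : Prop where
  eq_one_of_inv_mem : ∀ x ∈ M, x⁻¹ ∈ M → x = 1
  delta_mem : δ ∈ M
  conj_mem : ∀ x ∈ M, δ * x * δ⁻¹ ∈ M
  conj_inv_mem : ∀ x ∈ M, δ⁻¹ * x * δ ∈ M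
  exists_meet : ∀ s t, IsSimple M δ s → IsSimple M δ t →
    ∃ m, IsSimple M δ m ∧ s * m⁻¹ ∈ M ∧ t * m⁻¹ ∈ M ∧
      ∀ x ∈ M, s * x⁻¹ ∈ M → t * x⁻¹ ∈ M → m * x⁻¹ ∈ M

/-- The relations of the monoid presented by the simple elements: `[s] [t] = [s t]` whenever
`s`, `t` and `s t` are simple, and `[1] = 1`. -/
inductive SimpleRel {G : Type*} [Group G] (M : Submonoid G) (δ : G) :
    FreeMonoid {s : G // IsSimple M δ s} → FreeMonoid {s : G // IsSimple M δ s} → Prop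
  | mul (s t u : {s : G // IsSimple M δ s}) (h : (s : G) * t = u) :
      SimpleRel M δ (FreeMonoid.of s * FreeMonoid.of t) (FreeMonoid.of u)
  | one (s : {s : G // IsSimple M δ s}) (h : (s : G) = 1) : SimpleRel M δ (FreeMonoid.of s) 1

/-- The monoid generated by the simple elements, subject to the relations that hold between
products of two of them inside the set of simple elements. -/
abbrev SimpleMonoid {G : Type*} [Group G] (M : Submonoid G) (δ : G) : Type _ :=
  PresentedMonoid (SimpleRel M δ)

/-- The group `G` has the universal property of the group presented by the simple elements: every
map from the simple elements to a group that is multiplicative wherever products stay simple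
extends to a homomorphism on `G`. -/
def ExtendsFromSimples {G : Type} [Group G] (M : Submonoid G) (δ : G) : Prop :=
  ∀ (K : Type) [Group K] (f : {s : G // IsSimple M δ s} → K),
    (∀ s t u : {s : G // IsSimple M δ s}, (s : G) * t = u → f s * f t = f u) →
    ∃ ψ : G →* K, ∀ s : {s : G // IsSimple M δ s}, ψ s = f s

namespace IsGarside

variable {G : Type*} [Group G] {M : Submonoid G} {δ : G}

/-- Left factors of simple elements are right-divisors of `δ` as well, as `δ` is quasi-central. -/
theorem simple_left (h : IsGarside M δ) {x y : G} (hx : x ∈ M) (hy : y ∈ M)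
    (hxy : IsSimple M δ (x * y)) : IsSimple M δ x := by
  refine ⟨hx, ?_⟩
  have := M.mul_mem (h.conj_mem y hy) hxy.2
  simpa [mul_assoc] using this

theorem simple_right {x y : G} (hx : x ∈ M) (hy : y ∈ M)
    (hxy : IsSimple M δ (x * y)) : IsSimple M δ y := by
  refine ⟨hy, ?_⟩
  have := M.mul_mem hxy.2 hx
  simpa [mul_assoc] using this

theorem simple_one (h : IsGarside M δ) : IsSimple M δ 1 := ⟨M.one_mem, by simpa using h.delta_mem⟩

theorem simple_delta (h : IsGarside M δ) : IsSimple M δ δ := ⟨h.delta_mem, by simp⟩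

theorem simple_conj (h : IsGarside M δ) {s : G} (hs : IsSimple M δ s) :
    IsSimple M δ (δ * s * δ⁻¹) := by
  refine ⟨h.conj_mem _ hs.1, ?_⟩
  have := h.conj_mem _ hs.2
  simpa [mul_assoc] using this

theorem simple_conj_inv (h : IsGarside M δ) {s : G} (hs : IsSimple M δ s) :
    IsSimple M δ (δ⁻¹ * s * δ) := by
  refine ⟨h.conj_inv_mem _ hs.1, ?_⟩
  have := h.conj_inv_mem _ hs.2
  simpa [mul_assoc] using this

theorem simple_compl (h : IsGarside M δ) {s : G} (hs : IsSimple M δ s) :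
    IsSimple M δ (δ * s⁻¹) :=
  h.simple_left hs.2 hs.1 (by simpa using h.simple_delta)

/-- The greatest common right-divisor of two simple elements. -/
noncomputable def meet (h : IsGarside M δ) (s t : {s : G // IsSimple M δ s}) :
    {s : G // IsSimple M δ s} :=
  ⟨(h.exists_meet s t s.2 t.2).choose, (h.exists_meet s t s.2 t.2).choose_spec.1⟩

theorem meet_left (h : IsGarside M δ) (s t : {s : G // IsSimple M δ s}) :
    (s : G) * (h.meet s t : G)⁻¹ ∈ M := (h.exists_meet s t s.2 t.2).choose_spec.2.1

theorem meet_right (h : IsGarside M δ) (s t : {s : G // IsSimple M δ s}) :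
    (t : G) * (h.meet s t : G)⁻¹ ∈ M := (h.exists_meet s t s.2 t.2).choose_spec.2.2.1

theorem le_meet (h : IsGarside M δ) (s t : {s : G // IsSimple M δ s}) {x : G} (hx : x ∈ M)
    (hs : (s : G) * x⁻¹ ∈ M) (ht : (t : G) * x⁻¹ ∈ M) : (h.meet s t : G) * x⁻¹ ∈ M :=
  (h.exists_meet s t s.2 t.2).choose_spec.2.2.2 x hx hs ht

theorem eq_of_dvd_dvd (h : IsGarside M δ) {x y : G} (h1 : x * y⁻¹ ∈ M) (h2 : y * x⁻¹ ∈ M) :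
    x = y :=
  mul_inv_eq_one.1 (h.eq_one_of_inv_mem _ h1 (by simpa using h2))

/-- The left complement `δ s⁻¹` of a simple element, as a simple element. -/
def compl (h : IsGarside M δ) (s : {s : G // IsSimple M δ s}) : {s : G // IsSimple M δ s} :=
  ⟨δ * (s : G)⁻¹, h.simple_compl s.2⟩

/-- The quotient `s (s ∧ t)⁻¹`, as a simple element. -/
noncomputable def rest (h : IsGarside M δ) (s t : {s : G // IsSimple M δ s}) :
    {s : G // IsSimple M δ s} :=
  ⟨(s : G) * (h.meet s t : G)⁻¹,
    h.simple_left (h.meet_left s t) (h.meet s t).2.1 (by simpa using s.2)⟩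

/-- The product `(a ∧ δ t⁻¹) t`, as a simple element: the greatest simple right-divisor
of `a t`. -/
noncomputable def absorb (h : IsGarside M δ) (a t : {s : G // IsSimple M δ s}) :
    {s : G // IsSimple M δ s} :=
  ⟨(h.meet a (h.compl t) : G) * t, M.mul_mem (h.meet _ _).2.1 t.2.1, by
    simpa [compl, mul_assoc] using h.meet_right a (h.compl t)⟩

/-- The effect of right multiplication by the simple element `t` on a pair `(y, a)` that stands
for the product `y [a]` with `a` its greatest simple right-divisor. -/
noncomputable def step (h : IsGarside M δ) (t : {s : G // IsSimple M δ s})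
    (p : SimpleMonoid M δ × {s : G // IsSimple M δ s}) :
    SimpleMonoid M δ × {s : G // IsSimple M δ s} :=
  (p.1 * PresentedMonoid.of (SimpleRel M δ) (h.rest p.2 (h.compl t)), h.absorb p.2 t)

theorem of_mul_of {s t u : {s : G // IsSimple M δ s}} (e : (s : G) * t = u) :
    PresentedMonoid.of (SimpleRel M δ) s * PresentedMonoid.of (SimpleRel M δ) t =
      PresentedMonoid.of (SimpleRel M δ) u :=
  PresentedMonoid.mk_eq_mk_of_rel (SimpleRel.mul s t u e)

theorem of_eq_one {s : {s : G // IsSimple M δ s}} (e : (s : G) = 1) :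
    PresentedMonoid.of (SimpleRel M δ) s = 1 :=
  PresentedMonoid.mk_eq_mk_of_rel (SimpleRel.one s e)

/-- The steps respect the relation `[t] [u] = [w]`: the meet taken in the second step is the meet
of the single step, multiplied by `t`. -/
theorem step_step (h : IsGarside M δ) {t u w : {s : G // IsSimple M δ s}} (e : (t : G) * u = w)
    (p : SimpleMonoid M δ × {s : G // IsSimple M δ s}) :
    h.step u (h.step t p) = h.step w p := by
  obtain ⟨y, a⟩ := p
  set v := h.meet a (h.compl t) with hv
  set v₂ := h.meet (h.absorb a t) (h.compl u) with hv₂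
  set z := h.meet a (h.compl w) with hz
  -- the meet defining the second step is the one for the product, times `t`
  have hcu : (h.compl u : G) * (t : G)⁻¹ = h.compl w := by simp [compl, ← e, mul_assoc]
  have hct : (h.compl t : G) * (h.compl w : G)⁻¹ ∈ M := by
    have := h.conj_mem _ u.2.1
    simpa [compl, ← e, mul_assoc] using this
  have hzv : (v : G) * (z : G)⁻¹ ∈ M := by
    refine h.le_meet _ _ z.2.1 (h.meet_left _ _) ?_
    have := M.mul_mem hct (h.meet_right a (h.compl w))
    simpa [mul_assoc] using this
  have habs : (h.absorb a t : G) = v * t := rfl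
  have key : (v₂ : G) = z * t := by
    refine h.eq_of_dvd_dvd ?_ ?_
    · refine h.le_meet _ _ (M.mul_mem z.2.1 t.2.1) ?_ ?_
      · rw [habs]; simpa [mul_assoc] using hzv
      · have := h.meet_right a (h.compl w)
        rw [← hcu] at this; simpa [mul_assoc] using this
    · have ht : (v₂ : G) * (t : G)⁻¹ ∈ M := by
        refine h.le_meet _ _ t.2.1 ?_ ?_
        · rw [habs]; simpa using v.2.1
        · rw [hcu]; exact (h.compl w).2.1
      have h1 := h.meet_left (h.absorb a t) (h.compl u)
      have h2 := h.meet_right (h.absorb a t) (h.compl u)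
      rw [← hv₂] at h1 h2
      have h3 : (v : G) * ((v₂ : G) * (t : G)⁻¹)⁻¹ ∈ M := by
        rw [habs] at h1; simpa [mul_assoc] using h1
      have := h.le_meet a (h.compl w) ht ?_ ?_
      · simpa [mul_assoc, ← hz] using this
      · have := M.mul_mem (h.meet_left a (h.compl t)) h3
        simpa [← hv, mul_assoc] using this
      · rw [← hcu]; simpa [mul_assoc] using h2
  refine Prod.ext ?_ (Subtype.ext ?_)
  · change y * PresentedMonoid.of _ (h.rest a (h.compl t)) *
      PresentedMonoid.of _ (h.rest (h.absorb a t) (h.compl u)) =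
      y * PresentedMonoid.of _ (h.rest a (h.compl w))
    rw [mul_assoc, of_mul_of]
    change (a : G) * (v : G)⁻¹ * ((h.absorb a t : G) * (v₂ : G)⁻¹) = a * (z : G)⁻¹
    rw [key, habs]; group
  · change (v₂ : G) * u = z * w
    rw [key, ← e, mul_assoc]

theorem step_one (h : IsGarside M δ) {t : {s : G // IsSimple M δ s}} (e : (t : G) = 1)
    (p : SimpleMonoid M δ × {s : G // IsSimple M δ s}) : h.step t p = p := by
  obtain ⟨y, a⟩ := p
  have key : (h.meet a (h.compl t) : G) = a := by
    refine h.eq_of_dvd_dvd (h.le_meet _ _ a.2.1 (by simp) ?_) (h.meet_left _ _)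
    simpa [compl, e] using a.2.2
  refine Prod.ext ?_ (Subtype.ext ?_)
  · change y * PresentedMonoid.of _ (h.rest a (h.compl t)) = y
    rw [of_eq_one, mul_one]
    simp [rest, key]
  · simp [step, absorb, key, e]

/-- Right multiplication on pairs, as an action of the monoid presented by the simple elements. -/
noncomputable def stepHom (h : IsGarside M δ) :
    SimpleMonoid M δ →* (Function.End (SimpleMonoid M δ × {s : G // IsSimple M δ s}))ᵐᵒᵖ :=
  PresentedMonoid.lift
    (M := (Function.End (SimpleMonoid M δ × {s : G // IsSimple M δ s}))ᵐᵒᵖ)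
    (fun t => MulOpposite.op (h.step t)) (by
      rintro _ _ (⟨s, t, u, e⟩ | ⟨s, e⟩)
      · rw [map_mul, FreeMonoid.lift_eval_of, FreeMonoid.lift_eval_of, FreeMonoid.lift_eval_of]
        exact congrArg MulOpposite.op (funext fun p => h.step_step e p)
      · rw [map_one, FreeMonoid.lift_eval_of]
        exact congrArg MulOpposite.op (funext fun p => h.step_one e p))

/-- The pair `(y, a)` with `x = y [a]` and `a` the greatest simple right-divisor of `x`. -/
noncomputable def split (h : IsGarside M δ) (x : SimpleMonoid M δ) :
    SimpleMonoid M δ × {s : G // IsSimple M δ s} :=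
  (h.stepHom x).unop (1, ⟨1, h.simple_one⟩)

theorem split_mul_of (h : IsGarside M δ) (x : SimpleMonoid M δ) (t : {s : G // IsSimple M δ s}) :
    h.split (x * PresentedMonoid.of _ t) = h.step t (h.split x) := by
  rw [split, map_mul, MulOpposite.unop_mul]
  rfl

theorem induction_right {P : SimpleMonoid M δ → Prop} (one : P 1)
    (mul : ∀ x t, P x → P (x * PresentedMonoid.of _ t)) (x : SimpleMonoid M δ) : P x := by
  have hx : x ∈ Submonoid.closure (Set.range (PresentedMonoid.of (SimpleRel M δ))) := by
    rw [PresentedMonoid.closure_range_of]; trivial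
  induction hx using Submonoid.closure_induction_right with
  | one => exact one
  | mul_right x _ y hy ih => obtain ⟨t, rfl⟩ := hy; exact mul _ _ ih

theorem split_spec (h : IsGarside M δ) (x : SimpleMonoid M δ) :
    (h.split x).1 * PresentedMonoid.of _ (h.split x).2 = x := by
  induction x using induction_right with
  | one =>
    have e : h.split 1 = (1, ⟨1, h.simple_one⟩) := by rw [split, map_one]; rfl
    rw [e, of_eq_one rfl, mul_one]
  | mul x t ih =>
    rw [split_mul_of]
    conv_rhs => rw [← ih]
    generalize h.split x = p
    obtain ⟨y, a⟩ := p
    change y * PresentedMonoid.of _ (h.rest a (h.compl t)) * PresentedMonoid.of _ (h.absorb a t) = _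
    have e1 : PresentedMonoid.of (SimpleRel M δ) (h.absorb a t) =
        PresentedMonoid.of _ (h.meet a (h.compl t)) * PresentedMonoid.of _ t :=
      (of_mul_of rfl).symm
    have e2 : PresentedMonoid.of (SimpleRel M δ) (h.rest a (h.compl t)) *
        PresentedMonoid.of _ (h.meet a (h.compl t)) = PresentedMonoid.of _ a :=
      of_mul_of (by simp [rest])
    rw [e1, mul_assoc, ← mul_assoc (PresentedMonoid.of _ (h.rest a (h.compl t))), e2, mul_assoc]

theorem dvd_split (h : IsGarside M δ) (x : SimpleMonoid M δ) (t : {s : G // IsSimple M δ s}) :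
    ((h.split (x * PresentedMonoid.of _ t)).2 : G) * (t : G)⁻¹ ∈ M := by
  rw [split_mul_of]
  change (h.absorb (h.split x).2 t : G) * (t : G)⁻¹ ∈ M
  simpa [absorb] using (h.meet _ _).2.1

/-- Right-cancellation: `x` is recovered from `split (x [t])`, since the simple part `v t` of
`x [t]` determines `v`. -/
theorem right_cancel_of (h : IsGarside M δ) {x y : SimpleMonoid M δ}
    {t : {s : G // IsSimple M δ s}}
    (e : x * PresentedMonoid.of _ t = y * PresentedMonoid.of _ t) : x = y := by
  have key : ∀ z, z = (h.split (z * PresentedMonoid.of _ t)).1 *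
      PresentedMonoid.of _ (h.meet (h.split z).2 (h.compl t)) := by
    intro z
    rw [split_mul_of]
    change z = (h.split z).1 * PresentedMonoid.of _ (h.rest (h.split z).2 (h.compl t)) * _
    rw [mul_assoc, of_mul_of (u := (h.split z).2) (by simp [rest]), split_spec]
  have e2 : h.meet (h.split x).2 (h.compl t) = h.meet (h.split y).2 (h.compl t) := by
    have := congrArg (fun z => (h.split z).2) e
    simp only [split_mul_of] at this
    have := congrArg Subtype.val this
    exact Subtype.ext (mul_right_cancel (b := (t : G)) this)
  rw [key x, key y, e, e2]

theorem mul_right_cancel_simpleMonoid (h : IsGarside M δ) {x y z : SimpleMonoid M δ}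
    (e : x * z = y * z) : x = y := by
  induction z using induction_right with
  | one => simpa using e
  | mul z t ih => exact ih (h.right_cancel_of (by simpa [mul_assoc] using e))

/-- The endomorphism of the presented monoid induced by a conjugation of `G` that preserves the
simple elements. -/
noncomputable def conjHom (c : G)
    (hc : ∀ s, IsSimple M δ s → IsSimple M δ (c * s * c⁻¹)) :
    SimpleMonoid M δ →* SimpleMonoid M δ :=
  PresentedMonoid.lift (fun s => PresentedMonoid.of _ ⟨c * s * c⁻¹, hc s s.2⟩) (by
    rintro _ _ (⟨s, t, u, e⟩ | ⟨s, e⟩)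
    · simp only [map_mul, FreeMonoid.lift_eval_of]
      exact of_mul_of (by simp [← e, mul_assoc])
    · simp only [map_one, FreeMonoid.lift_eval_of]
      exact of_eq_one (by simp [e]))

/-- The class of `δ` in the presented monoid. -/
def deltaClass (h : IsGarside M δ) : SimpleMonoid M δ :=
  PresentedMonoid.of _ ⟨δ, h.simple_delta⟩

/-- The automorphism `x ↦ δ x δ⁻¹`, on the presented monoid. -/
noncomputable def rot (h : IsGarside M δ) : SimpleMonoid M δ →* SimpleMonoid M δ :=
  conjHom δ fun _ hs => h.simple_conj hs

theorem deltaClass_mul (h : IsGarside M δ) (x : SimpleMonoid M δ) :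
    h.deltaClass * x = h.rot x * h.deltaClass := by
  induction x using induction_right with
  | one => simp
  | mul x t ih =>
    have e1 : PresentedMonoid.of (SimpleRel M δ) (h.compl t) * PresentedMonoid.of _ t =
        h.deltaClass := of_mul_of (by simp [compl])
    have e2 : h.rot (PresentedMonoid.of _ t) * PresentedMonoid.of (SimpleRel M δ) (h.compl t) =
        h.deltaClass := of_mul_of (by simp [compl])
    rw [← mul_assoc, ih, map_mul, mul_assoc, mul_assoc]
    congr 1
    rw [← e2, mul_assoc, e1, e2]

theorem rot_injective (h : IsGarside M δ) : Function.Injective h.rot := by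
  have hinv : Function.LeftInverse
      (conjHom δ⁻¹ fun s hs => by simpa using h.simple_conj_inv hs :
        SimpleMonoid M δ →* SimpleMonoid M δ) h.rot := by
    intro x
    induction x using induction_right with
    | one => simp
    | mul x t ih =>
      rw [map_mul, map_mul, ih]
      congr 1
      change PresentedMonoid.of _ _ = PresentedMonoid.of _ _
      congr 1
      ext
      simp [mul_assoc]
  exact hinv.injective

theorem pow_deltaClass_mul (h : IsGarside M δ) (k : ℕ) (x : SimpleMonoid M δ) :
    h.deltaClass ^ k * x = h.rot^[k] x * h.deltaClass ^ k := by
  induction k generalizing x with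
  | zero => simp
  | succ k ih => rw [pow_succ, mul_assoc, deltaClass_mul, ← mul_assoc, ih, mul_assoc,
      Function.iterate_succ_apply]

theorem pow_deltaClass_left_cancel (h : IsGarside M δ) {k : ℕ} {x y : SimpleMonoid M δ}
    (e : h.deltaClass ^ k * x = h.deltaClass ^ k * y) : x = y := by
  rw [pow_deltaClass_mul, pow_deltaClass_mul] at e
  exact h.rot_injective.iterate k (h.mul_right_cancel_simpleMonoid e)

/-- The powers of `δ` form an Ore set, because `δ` is quasi-central. -/
@[reducible] noncomputable def oreSet (h : IsGarside M δ) :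
    OreLocalization.OreSet (Submonoid.powers h.deltaClass) where
  ore_right_cancel _ _ _ e := ⟨1, by rw [h.mul_right_cancel_simpleMonoid e]⟩
  oreNum r s := h.rot^[s.2.choose] r
  oreDenom _ s := s
  ore_eq r s := by
    have := h.pow_deltaClass_mul s.2.choose r
    have hs : h.deltaClass ^ s.2.choose = s := s.2.choose_spec
    rwa [hs] at this

/-- The canonical map from the presented monoid to `G`. -/
noncomputable def eval : SimpleMonoid M δ →* G :=
  PresentedMonoid.lift (fun s : {s : G // IsSimple M δ s} => (s : G)) (by
    rintro _ _ (⟨s, t, u, e⟩ | ⟨s, e⟩)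
    · simpa using e
    · simpa using e)

theorem eval_mem (x : SimpleMonoid M δ) : eval x ∈ M := by
  induction x using induction_right with
  | one => simp
  | mul x t ih => rw [map_mul]; exact M.mul_mem ih t.2.1

/-- The presented monoid embeds in `G`: its localization at the powers of `δ` is a monoid in which
all simple elements are invertible, so the universal property of `G` gives a left inverse of
`eval` up to the embedding in the localization. -/
theorem eval_injective {G : Type} [Group G] {M : Submonoid G} {δ : G} (h : IsGarside M δ)
    (hlift : ExtendsFromSimples M δ) :
    Function.Injective (eval : SimpleMonoid M δ →* G) := by
  let _ := h.oreSet
  let R := OreLocalization (Submonoid.powers h.deltaClass) (SimpleMonoid M δ)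
  let ι : SimpleMonoid M δ →* R := OreLocalization.numeratorHom
  have hι : Function.Injective ι := by
    intro x y e
    change x /ₒ (1 : Submonoid.powers h.deltaClass) = y /ₒ 1 at e
    obtain ⟨u, v, e1, e2⟩ := OreLocalization.oreDiv_eq_iff.1 e
    obtain ⟨_, k, rfl⟩ := u
    simp only [OneMemClass.coe_one, mul_one] at e2
    rw [← e2] at e1
    exact (h.pow_deltaClass_left_cancel (k := k) e1).symm
  have hδ : IsUnit (ι h.deltaClass) :=
    OreLocalization.numerator_isUnit
      (⟨h.deltaClass, Submonoid.mem_powers _⟩ : Submonoid.powers h.deltaClass)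
  -- every simple element divides `δ` on both sides, hence becomes invertible
  have hu : ∀ s : {s : G // IsSimple M δ s}, IsUnit (ι (PresentedMonoid.of _ s)) := by
    intro s
    have e1 : PresentedMonoid.of (SimpleRel M δ) (h.compl s) * PresentedMonoid.of _ s =
        h.deltaClass := of_mul_of (by simp [compl])
    have e2 : PresentedMonoid.of (SimpleRel M δ) s *
        PresentedMonoid.of _ ⟨δ⁻¹ * (h.compl s : G) * δ, h.simple_conj_inv (h.compl s).2⟩ =
        h.deltaClass := of_mul_of (by simp [compl])
    obtain ⟨d, hd⟩ := hδ
    refine isUnit_iff_exists_and_exists.2 ⟨⟨ι (PresentedMonoid.of _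
        ⟨δ⁻¹ * (h.compl s : G) * δ, h.simple_conj_inv (h.compl s).2⟩) * ↑d⁻¹, ?_⟩,
      ⟨↑d⁻¹ * ι (PresentedMonoid.of _ (h.compl s)), ?_⟩⟩
    · rw [← mul_assoc, ← map_mul, e2, ← hd, Units.mul_inv]
    · rw [mul_assoc, ← map_mul, e1, ← hd, Units.inv_mul]
  obtain ⟨ψ, hψ⟩ := hlift Rˣ (fun s => (hu s).unit) (by
    intro s t u e
    ext
    simp only [Units.val_mul, IsUnit.unit_spec]
    rw [← map_mul, of_mul_of e])
  have comp : ∀ x, ((ψ (eval x) : Rˣ) : R) = ι x := by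
    intro x
    induction x using induction_right with
    | one => simp
    | mul x t ih =>
      rw [map_mul, map_mul, map_mul, Units.val_mul, ih]
      congr 1
      change ((ψ t : Rˣ) : R) = _
      rw [hψ]; rfl
  intro x y e
  apply hι
  rw [← comp, ← comp, e]

theorem eval_surjOn (hgen : M ≤ Submonoid.closure {s | IsSimple M δ s}) {x : G} (hx : x ∈ M) :
    ∃ y : SimpleMonoid M δ, eval y = x := by
  have : Submonoid.closure {s | IsSimple M δ s} ≤
      MonoidHom.mrange (eval : SimpleMonoid M δ →* G) := by
    rw [Submonoid.closure_le]
    exact fun s hs => ⟨PresentedMonoid.of _ ⟨s, hs⟩, rfl⟩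
  exact this (hgen hx)

/-- Among the simple right-divisors of an element of `M` there is a greatest one. -/
theorem exists_head {G : Type} [Group G] {M : Submonoid G} {δ : G} (h : IsGarside M δ)
    (hlift : ExtendsFromSimples M δ) (hgen : M ≤ Submonoid.closure {s | IsSimple M δ s})
    {x : G} (hx : x ∈ M) :
    ∃ a, IsSimple M δ a ∧ x * a⁻¹ ∈ M ∧
      ∀ s, IsSimple M δ s → x * s⁻¹ ∈ M → a * s⁻¹ ∈ M := by
  obtain ⟨y, rfl⟩ := eval_surjOn hgen hx
  refine ⟨(h.split y).2, (h.split y).2.2, ?_, ?_⟩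
  · have e := congrArg eval (h.split_spec y)
    rw [map_mul] at e
    have e' : eval (h.split y).1 * ((h.split y).2 : G) = eval y := e
    rw [← eq_mul_inv_iff_mul_eq.mpr e']
    exact eval_mem _
  · intro s hs hd
    obtain ⟨z, hz⟩ := eval_surjOn hgen hd
    have e : z * PresentedMonoid.of _ ⟨s, hs⟩ = y := by
      apply h.eval_injective hlift
      rw [map_mul, hz]
      exact inv_mul_cancel_right _ _
    rw [← e]
    exact h.dvd_split z ⟨s, hs⟩

/-- `M` has the universal property of the monoid presented by the simple elements. -/
theorem exists_extend {G : Type} [Group G] {M : Submonoid G} {δ : G} (h : IsGarside M δ)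
    (hlift : ExtendsFromSimples M δ) (hgen : M ≤ Submonoid.closure {s | IsSimple M δ s})
    {K : Type*} [Monoid K] (f : {s : G // IsSimple M δ s} → K)
    (hmul : ∀ s t u : {s : G // IsSimple M δ s}, (s : G) * t = u → f s * f t = f u)
    (hone : ∀ s : {s : G // IsSimple M δ s}, (s : G) = 1 → f s = 1) :
    ∃ ρ : M →* K, ∀ s : {s : G // IsSimple M δ s}, ρ ⟨s, s.2.1⟩ = f s := by
  let e : SimpleMonoid M δ ≃* M := MulEquiv.ofBijective
    (eval.codRestrict M eval_mem : SimpleMonoid M δ →* M) ⟨fun x y hxy =>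
      h.eval_injective hlift (congrArg Subtype.val hxy), fun x =>
        (eval_surjOn hgen x.2).imp fun y hy => Subtype.ext hy⟩
  let F : SimpleMonoid M δ →* K := PresentedMonoid.lift f (by
    rintro _ _ (⟨s, t, u, e⟩ | ⟨s, e⟩)
    · simpa using hmul s t u e
    · simpa using hone s e)
  refine ⟨F.comp e.symm.toMonoidHom, fun s => ?_⟩
  have : e.symm ⟨s, s.2.1⟩ = PresentedMonoid.of _ s := by
    rw [MulEquiv.symm_apply_eq]; rfl
  change F (e.symm ⟨s, s.2.1⟩) = f s
  rw [this]; rfl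

end IsGarside

/-! ### The Garside structure of the dual braid monoid -/

/-- The equivalence relation on `ℕ` whose only nontrivial class is `{1, …, m}`. -/
def topRel (m : ℕ) : Setoid ℕ where
  r x y := x = y ∨ ((1 ≤ x ∧ x ≤ m) ∧ 1 ≤ y ∧ y ≤ m)
  iseqv :=
    { refl := fun _ => Or.inl rfl
      symm := fun h => by omega
      trans := fun h h' => by omega }

theorem topRel_iff {m x y : ℕ} :
    topRel m x y ↔ x = y ∨ ((1 ≤ x ∧ x ≤ m) ∧ 1 ≤ y ∧ y ≤ m) := Iff.rfl

theorem isNoncrossing_topRel {m n : ℕ} (h : m ≤ n) : IsNoncrossing n (topRel m) where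
  supp i j hij hne := by rw [topRel_iff] at hij; omega
  nc i j k l h1 h2 h3 h4 h5 := by rw [topRel_iff] at *; omega

theorem le_topRel_iff {m : ℕ} {r : Setoid ℕ} :
    r ≤ topRel m ↔ ∀ i j, r i j → i ≠ j → 1 ≤ i ∧ i ≤ m := by
  constructor
  · intro h i j hij hne
    have := topRel_iff.1 (h hij)
    omega
  · intro h i j hij
    by_cases hne : i = j
    · exact Or.inl hne
    · exact Or.inr ⟨h i j hij hne, h j i (r.symm hij) (Ne.symm hne)⟩

theorem ncBraid_topRel {m n : ℕ} (h : m ≤ n) : ncBraid n (topRel m) = artinProd n 1 m := by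
  have h1 : ∀ k, k ≤ m → partialBraid n (topRel m) k = artinProd n 1 k := by
    intro k hk
    induction k with
    | zero => rfl
    | succ k ih =>
      have e : pred (topRel m) (k + 1) = k := (pred_eq_iff (by omega)).2
        ⟨by omega, fun _ => Or.inr (by omega), fun i _ _ => by omega⟩
      rw [partialBraid, ih (by omega), e]
      rcases Nat.eq_zero_or_pos k with rfl | hk0
      · simp [artinProd]
      · rw [arc_eq hk0 (by omega), bklGen_self_succ, artinProd_succ n hk0]
  have h2 : ∀ k, m ≤ k → partialBraid n (topRel m) k = artinProd n 1 m := by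
    intro k hk
    induction k, hk using Nat.le_induction with
    | base => exact h1 m le_rfl
    | succ k hk ih =>
      have e : pred (topRel m) (k + 1) = 0 := (pred_eq_iff (by omega)).2
        ⟨by omega, fun h => absurd rfl h, fun i _ _ hi => by rw [topRel_iff] at hi; omega⟩
      rw [partialBraid, ih, e, arc_zero, mul_one]
  exact h2 n h

theorem ncBraid_topRel_self (n : ℕ) : ncBraid n (topRel n) = braidDelta n :=
  ncBraid_topRel le_rfl

theorem isSimple_iff {n : ℕ} {x : BraidGroup n} :
    IsSimple (dualBraidMonoid n) (braidDelta n) x ↔ ∃ r, IsNoncrossing n r ∧ x = ncBraid n r := by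
  constructor
  · rintro ⟨hx, hx'⟩
    obtain ⟨s, hs, -, e⟩ := exists_ncBraid_eq (isNoncrossing_topRel le_rfl) hx' hx
      (by rw [inv_mul_cancel_right, ncBraid_topRel_self])
    exact ⟨s, hs, e⟩
  · rintro ⟨r, hr, rfl⟩
    refine ⟨ncBraid_mem n r, ?_⟩
    rw [← ncBraid_topRel_self]
    exact ncBraid_dvd_of_le (isNoncrossing_topRel le_rfl) hr (le_topRel_iff.2 hr.supp)

theorem IsNoncrossing.inf {n : ℕ} {r s : Setoid ℕ} (hr : IsNoncrossing n r)
    (hs : IsNoncrossing n s) : IsNoncrossing n (r ⊓ s) where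
  supp i j h := hr.supp i j h.1
  nc i j k l h1 h2 h3 h4 h5 :=
    ⟨hr.nc i j k l h1 h2 h3 h4.1 h5.1, hs.nc i j k l h1 h2 h3 h4.2 h5.2⟩

/-- `δ_n` is a Garside element of the dual braid monoid; meets of simple elements come from
intersections of noncrossing partitions. -/
theorem isGarside_braidDelta (n : ℕ) : IsGarside (dualBraidMonoid n) (braidDelta n) where
  eq_one_of_inv_mem _ hx hx' := eq_one_of_inv_mem hx hx'
  delta_mem := by rw [← ncBraid_topRel_self]; exact ncBraid_mem n _
  conj_mem x hx := rotAut_mem hx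
  conj_inv_mem x hx := by
    have := rotAut_symm_mem hx
    rwa [rotAut, MulAut.conj_symm_apply] at this
  exists_meet s t hs ht := by
    obtain ⟨r, hr, rfl⟩ := isSimple_iff.1 hs
    obtain ⟨r', hr', rfl⟩ := isSimple_iff.1 ht
    refine ⟨ncBraid n (r ⊓ r'), isSimple_iff.2 ⟨_, hr.inf hr', rfl⟩,
      ncBraid_dvd_of_le hr (hr.inf hr') inf_le_left,
      ncBraid_dvd_of_le hr' (hr.inf hr') inf_le_right, fun x hx h1 h2 => ?_⟩
    obtain ⟨u, hu, hur, rfl⟩ := exists_ncBraid_eq hr h1 hx (inv_mul_cancel_right _ _)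
    exact ncBraid_dvd_of_le (hr.inf hr') hu (le_inf hur (le_of_ncBraid_dvd hu h2))

theorem artinProd_mem {n p q : ℕ} (hp : 1 ≤ p) (hq : q ≤ n) :
    artinProd n p q ∈ dualBraidMonoid n := by
  refine Submonoid.list_prod_mem _ ?_
  simp only [List.mem_map, List.mem_range'_1]
  rintro _ ⟨i, hi, rfl⟩
  rw [← bklGen_self_succ]
  exact bklGen_mem n (by omega) (by omega) (by omega)

theorem isSimple_artinProd {n p q : ℕ} (hp : 1 ≤ p) (hpq : p ≤ q) (hq : q ≤ n) :
    IsSimple (dualBraidMonoid n) (braidDelta n) (artinProd n p q) := by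
  have h := isGarside_braidDelta n
  have e : artinProd n 1 p * (artinProd n p q * artinProd n q n) = braidDelta n := by
    rw [artinProd_mul n hpq hq, artinProd_mul n hp (hpq.trans hq), braidDelta]
  have h1 : IsSimple (dualBraidMonoid n) (braidDelta n) (artinProd n p q * artinProd n q n) :=
    IsGarside.simple_right (artinProd_mem le_rfl (hpq.trans hq))
      (mul_mem (artinProd_mem hp hq) (artinProd_mem (hp.trans hpq) le_rfl))
      (by rw [e]; exact h.simple_delta)
  exact h.simple_left (artinProd_mem hp hq) (artinProd_mem (hp.trans hpq) le_rfl) h1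

theorem isSimple_bklGen {n p q : ℕ} (hp : 1 ≤ p) (hpq : p < q) (hq : q ≤ n) :
    IsSimple (dualBraidMonoid n) (braidDelta n) (bklGen n p q) := by
  obtain ⟨q, rfl⟩ : ∃ m, q = m + 1 := ⟨q - 1, by omega⟩
  have h := isSimple_artinProd hp hpq.le hq
  rw [artinProd_eq_bklGen_mul n (by omega)] at h
  exact (isGarside_braidDelta n).simple_left (bklGen_mem n hp hpq hq)
    (artinProd_mem hp (by omega)) h

theorem isSimple_artinGen {n i : ℕ} (hi : 1 ≤ i) (hin : i < n) :
    IsSimple (dualBraidMonoid n) (braidDelta n) (artinGen n i) := by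
  rw [← bklGen_self_succ]; exact isSimple_bklGen hi (by omega) hin

theorem isSimple_artinGen_mul_artinGen {n i j : ℕ} (hi : 1 ≤ i) (hij : i < j) (hjn : j < n) :
    IsSimple (dualBraidMonoid n) (braidDelta n) (artinGen n i * artinGen n j) := by
  -- `σ_i` is a right-divisor of `σ_i ⋯ σ_{j-1}`
  obtain ⟨x, hx, e⟩ : ∃ x ∈ dualBraidMonoid n, artinProd n i j = x * artinGen n i := by
    have hjn' : j ≤ n := hjn.le
    clear hjn
    induction j, hij using Nat.le_induction with
    | base => exact ⟨1, one_mem _, by simp [artinProd_succ]⟩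
    | succ j hij ih =>
      obtain ⟨x, hx, e⟩ := ih (by omega)
      refine ⟨bklGen n i (j + 1) * x, mul_mem (bklGen_mem n hi (by omega) hjn') hx, ?_⟩
      rw [artinProd_eq_bklGen_mul n (by omega), e, mul_assoc]
  have h := isSimple_artinProd hi (by omega : i ≤ j + 1) hjn
  rw [artinProd_succ n hij.le, e, mul_assoc] at h
  exact IsGarside.simple_right hx (mul_mem (isSimple_artinGen hi (by omega)).1
    (isSimple_artinGen (by omega) hjn).1) h

/-- The relations between simple elements imply Artin's relations. -/
theorem extendsFromSimples (n : ℕ) : ExtendsFromSimples (dualBraidMonoid n) (braidDelta n) := by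
  intro K _ f hf
  have h := isGarside_braidDelta n
  have hf1 : f ⟨1, h.simple_one⟩ = 1 := by
    have := hf ⟨1, h.simple_one⟩ ⟨1, h.simple_one⟩ ⟨1, h.simple_one⟩ (mul_one 1)
    simpa using this
  have hrel : ∀ r ∈ braidRels n, FreeGroup.lift
      (fun i : BraidIndex n => f ⟨artinGen n i, isSimple_artinGen i.2.1 i.2.2⟩) r = 1 := by
    rintro r ⟨⟨i, hi⟩, ⟨j, hj⟩, ⟨hij, rfl⟩ | ⟨hij, rfl⟩⟩
    · rw [map_mul, map_inv, mul_inv_eq_one]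
      simp only [map_mul, FreeGroup.lift_apply_of]
      dsimp only at hij
      have hs := isSimple_artinGen_mul_artinGen hi.1 (by omega : i < j) hj.2
      rw [hf _ _ ⟨_, hs⟩ rfl, hf _ _ ⟨_, hs⟩ (artinGen_commute n hij).eq.symm]
    · rw [map_mul, map_inv, mul_inv_eq_one]
      simp only [map_mul, FreeGroup.lift_apply_of]
      dsimp only at hij
      subst hij
      have hs := isSimple_artinGen_mul_artinGen hi.1 (by omega : i < i + 1) hj.2
      have ha := isSimple_bklGen hi.1 (by omega : i < i + 2) hj.2
      have e1 := bklGen_mul_eq_left n (by omega : i < i + 1) (by omega : i + 1 < i + 2)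
      have e2 := bklGen_mul_eq_right n hi.1 (by omega : i < i + 1) (by omega : i + 1 < i + 2) hj.2
      rw [bklGen_self_succ, bklGen_self_succ] at e1 e2
      have f1 := hf ⟨_, isSimple_artinGen hi.1 hi.2⟩ ⟨_, isSimple_artinGen hj.1 hj.2⟩ ⟨_, hs⟩ rfl
      have f2 := hf ⟨_, ha⟩ ⟨_, isSimple_artinGen hi.1 hi.2⟩ ⟨_, hs⟩ e1.symm
      have f3 := hf ⟨_, isSimple_artinGen hj.1 hj.2⟩ ⟨_, ha⟩ ⟨_, hs⟩ e2.symm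
      rw [f1, ← f3, mul_assoc, f2, ← f1, ← mul_assoc]
  refine ⟨PresentedGroup.toGroup hrel, ?_⟩
  set ψ := PresentedGroup.toGroup hrel with hψ
  have hgen : ∀ i (hi : 1 ≤ i) (hin : i < n),
      ψ (artinGen n i) = f ⟨artinGen n i, isSimple_artinGen hi hin⟩ := by
    intro i hi hin
    have e : artinGen n i = PresentedGroup.of ⟨i, hi, hin⟩ := dif_pos ⟨hi, hin⟩
    conv_lhs => rw [e]
    rw [hψ, PresentedGroup.toGroup.of]
  have hprod : ∀ p q (hp : 1 ≤ p) (hpq : p ≤ q) (hq : q ≤ n),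
      ψ (artinProd n p q) = f ⟨artinProd n p q, isSimple_artinProd hp hpq hq⟩ := by
    intro p q hp hpq
    induction q, hpq using Nat.le_induction with
    | base => intro hq; simp only [artinProd_self, map_one, hf1]
    | succ q hpq ih =>
      intro hq
      conv_lhs => rw [artinProd_succ n hpq, map_mul, ih (by omega), hgen q (by omega) hq]
      exact hf _ _ _ (artinProd_succ n hpq).symm
  have hbkl : ∀ p q (hp : 1 ≤ p) (hpq : p < q) (hq : q ≤ n),
      ψ (bklGen n p q) = f ⟨bklGen n p q, isSimple_bklGen hp hpq hq⟩ := by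
    intro p q hp hpq hq
    obtain ⟨q, rfl⟩ : ∃ m, q = m + 1 := ⟨q - 1, by omega⟩
    have e := artinProd_eq_bklGen_mul n (by omega : p ≤ q)
    have e1 := hf ⟨_, isSimple_bklGen hp hpq hq⟩ ⟨_, isSimple_artinProd hp (by omega) (by omega)⟩
      ⟨_, isSimple_artinProd hp hpq.le hq⟩ e.symm
    have e2 := congrArg ψ e
    rw [map_mul, hprod p _ hp hpq.le hq, hprod p q hp (by omega) (by omega), ← e1] at e2
    exact (mul_right_cancel e2).symm
  have hword : ∀ w, IsBKLWord n w → ∀ hs : IsSimple _ _ (evalWord n w),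
      ψ (evalWord n w) = f ⟨evalWord n w, hs⟩ := by
    intro w hw
    induction w with
    | nil => intro hs; simp only [evalWord_nil, map_one, hf1]
    | cons l w ih =>
      intro hs
      have hl := hw l (by simp)
      have hw' : IsBKLWord n w := fun l h => hw l (by simp [h])
      rw [evalWord_cons] at hs
      have hs' := IsGarside.simple_right (bklGen_mem n hl.1 hl.2.1 hl.2.2)
        (mem_dualBraidMonoid_iff.2 ⟨w, hw', rfl⟩) hs
      conv_lhs => rw [evalWord_cons, map_mul, ih hw' hs', hbkl _ _ hl.1 hl.2.1 hl.2.2]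
      exact hf _ _ _ rfl
  rintro ⟨s, hs⟩
  obtain ⟨w, hw, rfl⟩ := mem_dualBraidMonoid_iff.1 hs.1
  exact hword w hw hs

theorem dualBraidMonoid_le_closure (n : ℕ) :
    dualBraidMonoid n ≤
      Submonoid.closure {s | IsSimple (dualBraidMonoid n) (braidDelta n) s} := by
  refine Submonoid.closure_mono ?_
  rintro _ ⟨p, q, hp, hpq, hq, rfl⟩
  exact isSimple_bklGen hp hpq hq

/-! ### The inclusion of `B_{n-1}` -/

theorem braidIncl_artinGen {n i : ℕ} (hi : 1 ≤ i) (hin : i < n - 1) :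
    braidIncl n (artinGen (n - 1) i) = artinGen n i := by
  have e : artinGen (n - 1) i = PresentedGroup.of ⟨i, hi, hin⟩ := dif_pos ⟨hi, hin⟩
  rw [e, braidIncl, PresentedGroup.toGroup.of]

theorem braidIncl_artinProd {n p q : ℕ} (hp : 1 ≤ p) (hq : q ≤ n - 1) :
    braidIncl n (artinProd (n - 1) p q) = artinProd n p q := by
  rw [artinProd, map_list_prod, List.map_map, artinProd]
  congr 1
  refine List.map_congr_left fun i hi => ?_
  rw [List.mem_range'_1] at hi
  exact braidIncl_artinGen (by omega) (by omega)

theorem braidIncl_bklGen {n p q : ℕ} (hp : 1 ≤ p) (hpq : p < q) (hq : q ≤ n - 1) :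
    braidIncl n (bklGen (n - 1) p q) = bklGen n p q := by
  rw [bklGen, bklGen, map_mul, map_mul, map_inv, braidIncl_artinProd hp (by omega),
    braidIncl_artinGen (by omega) (by omega)]

theorem braidIncl_evalWord {n : ℕ} {w : BKLWord} (hw : IsBKLWord (n - 1) w) :
    braidIncl n (evalWord (n - 1) w) = evalWord n w := by
  induction w with
  | nil => simp
  | cons l w ih =>
    have hl := hw l (by simp)
    rw [evalWord_cons, evalWord_cons, map_mul, ih fun l h => hw l (by simp [h]),
      braidIncl_bklGen hl.1 hl.2.1 hl.2.2]

theorem isBKLWord_of_pred {n : ℕ} {w : BKLWord} (hw : IsBKLWord (n - 1) w) : IsBKLWord n w :=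
  fun l hl => ⟨(hw l hl).1, (hw l hl).2.1, (hw l hl).2.2.trans (Nat.sub_le n 1)⟩

theorem braidIncl_mem {n : ℕ} {x : BraidGroup (n - 1)} (hx : x ∈ dualBraidMonoid (n - 1)) :
    braidIncl n x ∈ dualBraidMonoid n := by
  obtain ⟨w, hw, rfl⟩ := mem_dualBraidMonoid_iff.1 hx
  rw [braidIncl_evalWord hw]
  exact mem_dualBraidMonoid_iff.2 ⟨w, isBKLWord_of_pred hw, rfl⟩

theorem len_braidIncl {n : ℕ} {x : BraidGroup (n - 1)} (hx : x ∈ dualBraidMonoid (n - 1)) :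
    len n (braidIncl n x) = len (n - 1) x := by
  obtain ⟨w, hw, rfl⟩ := mem_dualBraidMonoid_iff.1 hx
  rw [braidIncl_evalWord hw, len_evalWord n (isBKLWord_of_pred hw), len_evalWord _ hw]

theorem IsNoncrossing.of_pred {n : ℕ} {r : Setoid ℕ} (h : IsNoncrossing (n - 1) r) :
    IsNoncrossing n r where
  supp i j hij hne := by have := h.supp i j hij hne; omega
  nc := h.nc

theorem IsNoncrossing.to_pred {n : ℕ} {r : Setoid ℕ} (h : IsNoncrossing n r)
    (hle : r ≤ topRel (n - 1)) : IsNoncrossing (n - 1) r where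
  supp := le_topRel_iff.1 hle
  nc := h.nc

theorem braidIncl_ncBraid {n : ℕ} (hn : 1 ≤ n) {r : Setoid ℕ} (h : IsNoncrossing (n - 1) r) :
    braidIncl n (ncBraid (n - 1) r) = ncBraid n r := by
  have key : ∀ k, k ≤ n - 1 → braidIncl n (partialBraid (n - 1) r k) = partialBraid n r k := by
    intro k hk
    induction k with
    | zero => simp [partialBraid]
    | succ k ih =>
      rw [partialBraid, partialBraid, map_mul, ih (by omega), arc, arc]
      split_ifs with hc
      · rw [braidIncl_bklGen hc.1 hc.2 hk]
      · rw [map_one]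
  obtain ⟨m, rfl⟩ : ∃ m, n = m + 1 := ⟨n - 1, by omega⟩
  have e : pred r (m + 1) = 0 := (pred_eq_iff (by omega)).2 ⟨by omega, fun h => absurd rfl h,
    fun i _ hi hr => by have := h.supp _ _ (r.symm hr) (by omega); omega⟩
  rw [ncBraid, key _ le_rfl, ncBraid, partialBraid, e, arc_zero, mul_one, Nat.add_sub_cancel]

/-- The image of `B_{n-1}^{+*}` in `B_n`. -/
def inclMonoid (n : ℕ) : Submonoid (BraidGroup n) := (dualBraidMonoid (n - 1)).map (braidIncl n)

theorem inclMonoid_le (n : ℕ) : inclMonoid n ≤ dualBraidMonoid n := by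
  rintro _ ⟨x, hx, rfl⟩
  exact braidIncl_mem hx

theorem ncBraid_mem_inclMonoid {n : ℕ} (hn : 1 ≤ n) {r : Setoid ℕ}
    (h : IsNoncrossing (n - 1) r) : ncBraid n r ∈ inclMonoid n :=
  ⟨_, ncBraid_mem (n - 1) r, braidIncl_ncBraid hn h⟩

theorem permHom_of_mem_inclMonoid {n : ℕ} (hn : 1 ≤ n) {x : BraidGroup n}
    (hx : x ∈ inclMonoid n) : permHom n x n = n := by
  obtain ⟨y, hy, rfl⟩ := hx
  obtain ⟨w, hw, rfl⟩ := mem_dualBraidMonoid_iff.1 hy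
  rw [braidIncl_evalWord hw]
  induction w with
  | nil => simp
  | cons l w ih =>
    have hl := hw l (by simp)
    have hw' : IsBKLWord (n - 1) w := fun l h => hw l (by simp [h])
    rw [evalWord_cons, map_mul, Equiv.Perm.mul_apply,
      ih hw' (mem_dualBraidMonoid_iff.2 ⟨w, hw', rfl⟩),
      permHom_bklGen n hl.1 hl.2.1 (by omega), Equiv.swap_apply_of_ne_of_ne (by omega) (by omega)]

/-- A simple braid that lies in `B_{n-1}^{+*}` fixes `n`, hence its partition isolates `n`. -/
theorem isNoncrossing_pred_of_mem {n : ℕ} (hn : 1 ≤ n) {r : Setoid ℕ} (hr : IsNoncrossing n r)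
    (h : ncBraid n r ∈ inclMonoid n) : IsNoncrossing (n - 1) r := by
  have hfix := permHom_of_mem_inclMonoid hn h
  obtain ⟨h1, h2, h3⟩ := pred_spec r hn
  have h0 : pred r n = 0 := by
    by_contra h0
    have := (permHom_partialBraid (n := n) r le_rfl).2 n (mem_nonMin.2 ⟨⟨hn, le_rfl⟩, h0⟩)
    have := (permHom n (ncBraid n r)).injective (this.trans hfix.symm)
    omega
  refine hr.to_pred (le_topRel_iff.2 fun i j hij hne => ?_)
  have hi := hr.supp i j hij hne
  have hj := hr.supp j i (r.symm hij) (Ne.symm hne)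
  refine ⟨hi.1, ?_⟩
  by_contra hcon
  obtain rfl : i = n := by omega
  exact h3 j (by omega) (by omega) (r.symm hij)

/-- Left factors of simple elements of `B_{n-1}^{+*}` lie in `B_{n-1}^{+*}`. -/
theorem mem_inclMonoid_of_mul {n : ℕ} {r : Setoid ℕ} (hr : IsNoncrossing (n - 1) r)
    {x y : BraidGroup n} (hx : x ∈ dualBraidMonoid n) (hy : y ∈ dualBraidMonoid n)
    (h : x * y = ncBraid n r) : x ∈ inclMonoid n := by
  obtain ⟨⟨w, hw, rfl, hrel⟩, -⟩ := rel_of_mul_eq hx hy h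
  have hw' : IsBKLWord (n - 1) w := fun l hl =>
    ⟨(hw l hl).1, (hw l hl).2.1, (hr.supp l.2 l.1 (r.symm (hrel l hl))
      (by have := (hw l hl).2.1; omega)).2⟩
  exact ⟨_, mem_dualBraidMonoid_iff.2 ⟨w, hw', rfl⟩, braidIncl_evalWord hw'⟩

open Classical in
/-- The inclusion of `B_{n-1}^{+*}` in `B_n^{+*}` is injective: mapping a simple braid to itself if
its partition isolates `n`, and to `0` otherwise, defines a homomorphism on `B_n^{+*}` that
retracts it. -/
theorem braidIncl_injOn {n : ℕ} (hn : 1 ≤ n) :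
    Set.InjOn (braidIncl n) (dualBraidMonoid (n - 1)) := by
  let f : {s : BraidGroup n // IsSimple (dualBraidMonoid n) (braidDelta n) s} →
      WithZero (BraidGroup (n - 1)) := fun s =>
    if h : ∃ r, IsNoncrossing (n - 1) r ∧ (s : BraidGroup n) = ncBraid n r then
      ((ncBraid (n - 1) h.choose : BraidGroup (n - 1)) : WithZero (BraidGroup (n - 1))) else 0
  have hf : ∀ (s : {s : BraidGroup n // IsSimple (dualBraidMonoid n) (braidDelta n) s}) r,
      IsNoncrossing (n - 1) r → (s : BraidGroup n) = ncBraid n r →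
      f s = ((ncBraid (n - 1) r : BraidGroup (n - 1)) : WithZero (BraidGroup (n - 1))) := by
    intro s r hr hs
    have hex : ∃ r, IsNoncrossing (n - 1) r ∧ (s : BraidGroup n) = ncBraid n r := ⟨r, hr, hs⟩
    have e : hex.choose = r := ncBraid_injective hex.choose_spec.1.of_pred hr.of_pred
      (hex.choose_spec.2.symm.trans hs)
    simp only [f, dif_pos hex, e]
  obtain ⟨ρ, hρ⟩ := (isGarside_braidDelta n).exists_extend (extendsFromSimples n)
    (dualBraidMonoid_le_closure n) f (by
      rintro ⟨s, hs⟩ ⟨t, ht⟩ ⟨u, hu⟩ e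
      dsimp only at e
      by_cases hex : ∃ r, IsNoncrossing (n - 1) r ∧ u = ncBraid n r
      · obtain ⟨r, hr, rfl⟩ := hex
        obtain ⟨r₂, hr₂, hle, rfl⟩ := exists_ncBraid_eq hr.of_pred hs.1 ht.1 e
        have hr₂' : IsNoncrossing (n - 1) r₂ :=
          hr₂.to_pred (hle.trans (le_topRel_iff.2 hr.supp))
        have hz : IsSimple (dualBraidMonoid (n - 1)) (braidDelta (n - 1))
            (ncBraid (n - 1) r * (ncBraid (n - 1) r₂)⁻¹) :=
          (isGarside_braidDelta (n - 1)).simple_left (ncBraid_dvd_of_le hr hr₂' hle)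
            (ncBraid_mem _ r₂) (by
              rw [inv_mul_cancel_right]; exact isSimple_iff.2 ⟨r, hr, rfl⟩)
        obtain ⟨r₁, hr₁, e₁⟩ := isSimple_iff.1 hz
        have hs₁ : s = ncBraid n r₁ := by
          rw [← braidIncl_ncBraid hn hr₁, ← e₁, map_mul, map_inv, braidIncl_ncBraid hn hr,
            braidIncl_ncBraid hn hr₂', ← e, mul_inv_cancel_right]
        rw [hf _ r₁ hr₁ hs₁, hf _ r₂ hr₂' rfl, hf _ r hr rfl, ← WithZero.coe_mul, ← e₁,
          inv_mul_cancel_right]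
      · have hu0 : f ⟨u, hu⟩ = 0 := dif_neg hex
        rw [hu0]
        by_contra hne
        obtain ⟨h1, h2⟩ := mul_ne_zero_iff.1 hne
        have hs' : ∃ r, IsNoncrossing (n - 1) r ∧ s = ncBraid n r := by
          by_contra hcon; exact h1 (dif_neg hcon)
        have ht' : ∃ r, IsNoncrossing (n - 1) r ∧ t = ncBraid n r := by
          by_contra hcon; exact h2 (dif_neg hcon)
        obtain ⟨r₁, hr₁, rfl⟩ := hs'
        obtain ⟨r₂, hr₂, rfl⟩ := ht'
        obtain ⟨r, hr, rfl⟩ := isSimple_iff.1 hu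
        refine hex ⟨r, isNoncrossing_pred_of_mem hn hr ?_, rfl⟩
        rw [← e]
        exact mul_mem (ncBraid_mem_inclMonoid hn hr₁) (ncBraid_mem_inclMonoid hn hr₂))
    (by
      rintro ⟨s, hs⟩ e
      dsimp only at e
      obtain ⟨r, hr, e'⟩ := isSimple_iff.1 (isGarside_braidDelta (n - 1)).simple_one
      subst e
      rw [hf _ r hr (by rw [← braidIncl_ncBraid hn hr, ← e', map_one]), ← e',
        WithZero.coe_one])
  have key : ∀ x (hx : x ∈ dualBraidMonoid (n - 1)), ρ ⟨braidIncl n x, braidIncl_mem hx⟩ = x := by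
    intro x hx
    induction hx using Submonoid.closure_induction with
    | mem x hx =>
      obtain ⟨p, q, hp, hpq, hq, rfl⟩ := hx
      obtain ⟨r, hr, e⟩ := isSimple_iff.1 (isSimple_bklGen hp hpq hq)
      have e' : braidIncl n (bklGen (n - 1) p q) = ncBraid n r := by
        rw [e, braidIncl_ncBraid hn hr]
      have hs : IsSimple (dualBraidMonoid n) (braidDelta n) (braidIncl n (bklGen (n - 1) p q)) := by
        rw [e']; exact isSimple_iff.2 ⟨r, hr.of_pred, rfl⟩
      have := hρ ⟨_, hs⟩
      rw [hf _ r hr e', ← e] at this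
      exact this
    | one =>
      have : (⟨braidIncl n 1, braidIncl_mem (one_mem _)⟩ : dualBraidMonoid n) = 1 :=
        Subtype.ext (map_one _)
      rw [this, map_one, WithZero.coe_one]
    | mul x y hx hy ihx ihy =>
      have : (⟨braidIncl n (x * y), braidIncl_mem (mul_mem hx hy)⟩ : dualBraidMonoid n) =
          ⟨braidIncl n x, braidIncl_mem hx⟩ * ⟨braidIncl n y, braidIncl_mem hy⟩ :=
        Subtype.ext (map_mul _ _ _)
      rw [this, map_mul, ihx, ihy, WithZero.coe_mul]
  intro x hx y hy e
  have h1 := key x hx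
  have h2 := key y hy
  have e' : (⟨braidIncl n x, braidIncl_mem hx⟩ : dualBraidMonoid n) =
      ⟨braidIncl n y, braidIncl_mem hy⟩ := Subtype.ext e
  rw [e', h2] at h1
  exact (WithZero.coe_inj.1 h1).symm

/-! ### Tails -/

/-- Among the simple right-divisors of a positive braid that lie in `B_{n-1}^{+*}` there is a
greatest one: the meet of its greatest simple right-divisor with `δ_{n-1}`. -/
theorem exists_inclHead {n : ℕ} {x : BraidGroup n} (hx : x ∈ dualBraidMonoid n) :
    ∃ r, IsNoncrossing (n - 1) r ∧ x * (ncBraid n r)⁻¹ ∈ dualBraidMonoid n ∧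
      ∀ s, IsNoncrossing (n - 1) s → x * (ncBraid n s)⁻¹ ∈ dualBraidMonoid n →
        ncBraid n r * (ncBraid n s)⁻¹ ∈ dualBraidMonoid n := by
  obtain ⟨a, ha, hxa, hmax⟩ := (isGarside_braidDelta n).exists_head (extendsFromSimples n)
    (dualBraidMonoid_le_closure n) hx
  obtain ⟨r, hr, rfl⟩ := isSimple_iff.1 ha
  have hr' : IsNoncrossing n (r ⊓ topRel (n - 1)) :=
    hr.inf (isNoncrossing_topRel (Nat.sub_le n 1))
  refine ⟨r ⊓ topRel (n - 1), hr'.to_pred inf_le_right, ?_, fun s hs hxs => ?_⟩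
  · have := mul_mem hxa (ncBraid_dvd_of_le hr hr' inf_le_left)
    simpa [mul_assoc] using this
  · have := hmax _ (isSimple_iff.2 ⟨s, hs.of_pred, rfl⟩) hxs
    exact ncBraid_dvd_of_le hr' hs.of_pred
      (le_inf (le_of_ncBraid_dvd hs.of_pred this) (le_topRel_iff.2 hs.supp))

theorem exists_atom_of_mem_inclMonoid {n : ℕ} (hn : 1 ≤ n) {x : BraidGroup n}
    (hx : x ∈ inclMonoid n) (h : x ≠ 1) :
    ∃ s, IsNoncrossing (n - 1) s ∧ len n (ncBraid n s) = 1 ∧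
      x * (ncBraid n s)⁻¹ ∈ inclMonoid n := by
  obtain ⟨y, hy, rfl⟩ := hx
  obtain ⟨p, q, hp, hpq, hq, hd⟩ := exists_bklGen_mul hy fun e => h (by rw [e, map_one])
  obtain ⟨s, hs, e⟩ := isSimple_iff.1 (isSimple_bklGen hp hpq hq)
  refine ⟨s, hs, ?_, ?_⟩
  · rw [← braidIncl_ncBraid hn hs, len_braidIncl (ncBraid_mem _ s), ← e,
      len_bklGen _ hp hpq hq]
  · rw [← braidIncl_ncBraid hn hs, ← e, ← map_inv, ← map_mul]
    exact ⟨_, hd, rfl⟩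

/-- Two right-divisors in `B_{n-1}^{+*}` of a positive braid `β` have a common left-multiple in
`B_{n-1}^{+*}` that right-divides `β`. -/
theorem exists_common_multiple {n : ℕ} (hn : 1 ≤ n) {β γ τ : BraidGroup n}
    (hβ : β ∈ dualBraidMonoid n) (hγ : γ ∈ inclMonoid n) (hτ : τ ∈ inclMonoid n)
    (hβγ : β * γ⁻¹ ∈ dualBraidMonoid n) (hβτ : β * τ⁻¹ ∈ dualBraidMonoid n) :
    ∃ g ∈ inclMonoid n, ∃ h ∈ inclMonoid n,
      g * γ = h * τ ∧ β * (g * γ)⁻¹ ∈ dualBraidMonoid n := by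
  obtain ⟨k, hk⟩ : ∃ k : ℕ, len n β < k := ⟨(len n β + 1).toNat, by omega⟩
  induction k generalizing β γ τ with
  | zero => have := len_nonneg hβ; simp at hk; omega
  | succ k ih =>
    by_cases hγ1 : γ = 1
    · exact ⟨τ, hτ, 1, one_mem _, by simp [hγ1], by simpa [hγ1] using hβτ⟩
    by_cases hτ1 : τ = 1
    · exact ⟨1, one_mem _, γ, hγ, by simp [hτ1], by simpa using hβγ⟩
    obtain ⟨s, hs, hs1, hγs⟩ := exists_atom_of_mem_inclMonoid hn hγ hγ1
    obtain ⟨t, ht, ht1, hτt⟩ := exists_atom_of_mem_inclMonoid hn hτ hτ1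
    obtain ⟨r, hr, hβr, hmax⟩ := exists_inclHead hβ
    have hβs : β * (ncBraid n s)⁻¹ ∈ dualBraidMonoid n := by
      have := mul_mem hβγ (inclMonoid_le n hγs)
      simpa [mul_assoc] using this
    have hβt : β * (ncBraid n t)⁻¹ ∈ dualBraidMonoid n := by
      have := mul_mem hβτ (inclMonoid_le n hτt)
      simpa [mul_assoc] using this
    have hrs := hmax s hs hβs
    have hrt := hmax t ht hβt
    have hrs' := mem_inclMonoid_of_mul hr hrs (ncBraid_mem n s) (inv_mul_cancel_right _ _)
    have hrt' := mem_inclMonoid_of_mul hr hrt (ncBraid_mem n t) (inv_mul_cancel_right _ _)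
    have hlr : 1 ≤ len n (ncBraid n r) := by
      have := len_nonneg hrs
      rw [len_mul, len_inv, hs1] at this
      omega
    push_cast at hk
    -- divide `β` by the two letters, then by the greatest simple divisor above both
    obtain ⟨g₁, hg₁, z, hz, e₁, d₁⟩ := ih hβs hγs hrs' (by simpa [mul_assoc] using hβγ)
      (by simpa [mul_assoc] using hβr) (by rw [len_mul, len_inv, hs1]; omega)
    obtain ⟨h₁, hh₁, w, hw, e₂, d₂⟩ := ih hβt hτt hrt' (by simpa [mul_assoc] using hβτ)
      (by simpa [mul_assoc] using hβr) (by rw [len_mul, len_inv, ht1]; omega)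
    rw [e₁] at d₁
    rw [e₂] at d₂
    obtain ⟨g₂, hg₂, h₂, hh₂, e₃, d₃⟩ := ih hβr hz hw (by simpa [mul_assoc] using d₁)
      (by simpa [mul_assoc] using d₂) (by rw [len_mul, len_inv]; omega)
    have f₁ : g₁ * γ = z * ncBraid n r := by
      rw [← mul_assoc, ← mul_assoc] at e₁; exact mul_right_cancel e₁
    have f₂ : h₁ * τ = w * ncBraid n r := by
      rw [← mul_assoc, ← mul_assoc] at e₂; exact mul_right_cancel e₂
    have f₃ : g₂ * g₁ * γ = g₂ * z * ncBraid n r := by rw [mul_assoc, f₁, mul_assoc]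
    refine ⟨g₂ * g₁, mul_mem hg₂ hg₁, h₂ * h₁, mul_mem hh₂ hh₁, ?_, ?_⟩
    · rw [f₃, mul_assoc h₂, f₂, ← mul_assoc, e₃]
    · rw [f₃]; simpa [mul_assoc] using d₃

theorem isRightDivisor_iff {n : ℕ} {γ β : BraidGroup n} :
    IsRightDivisor n γ β ↔ γ ∈ dualBraidMonoid n ∧ β * γ⁻¹ ∈ dualBraidMonoid n := by
  refine and_congr_right fun _ => ⟨?_, fun h => ⟨_, h, by simp⟩⟩
  rintro ⟨g, hg, rfl⟩
  simpa using hg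

theorem exists_isTail {n : ℕ} (hn : 1 ≤ n) {β : BraidGroup n} (hβ : β ∈ dualBraidMonoid n) :
    ∃ τ, IsTail n β τ := by
  -- start with `1` and enlarge the divisor until it is the tail
  have key : ∀ (k : ℕ) (τ : dualBraidMonoid (n - 1)),
      β * (braidIncl n τ)⁻¹ ∈ dualBraidMonoid n → len n (β * (braidIncl n τ)⁻¹) < k →
      ∃ τ, IsTail n β τ := by
    intro k
    induction k with
    | zero => intro τ h hk; have := len_nonneg h; simp at hk this; omega
    | succ k ih =>
      intro τ hτ hk
      by_cases hmax : ∀ γ : dualBraidMonoid (n - 1), IsRightDivisor n (braidIncl n γ) β →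
          IsRightDivisor n (braidIncl n γ) (braidIncl n τ)
      · exact ⟨τ, isRightDivisor_iff.2 ⟨braidIncl_mem τ.2, hτ⟩, hmax⟩
      · push Not at hmax
        obtain ⟨γ, h1, h2⟩ := hmax
        obtain ⟨g, hg, h, ⟨h', hh', rfl⟩, e, d⟩ := exists_common_multiple hn hβ
          ⟨γ, γ.2, rfl⟩ ⟨τ, τ.2, rfl⟩ (isRightDivisor_iff.1 h1).2 hτ
        rw [e, ← map_mul] at d
        refine ih ⟨h' * τ, mul_mem hh' τ.2⟩ d ?_
        have hpos : 0 < len n (braidIncl n h') := by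
          refine (len_nonneg (braidIncl_mem hh')).lt_of_ne fun h0 => h2 ?_
          have h0' := eq_one_of_len_eq_zero (braidIncl_mem hh') h0.symm
          rw [h0', one_mul] at e
          exact ⟨braidIncl_mem γ.2, g, inclMonoid_le n hg, e.symm⟩
        dsimp only
        rw [len_mul, len_inv] at hk ⊢
        rw [map_mul, len_mul]
        push_cast at hk
        omega
  exact key (len n β + 1).toNat 1 (by simpa using hβ) (by
    have := len_nonneg hβ
    simp only [OneMemClass.coe_one, map_one, inv_one, mul_one]
    omega)

theorem isTail_unique {n : ℕ} (hn : 1 ≤ n) {β : BraidGroup n} {τ τ' : dualBraidMonoid (n - 1)}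
    (h : IsTail n β τ) (h' : IsTail n β τ') : τ = τ' := by
  have h1 := (isRightDivisor_iff.1 (h.2 τ' h'.1)).2
  have h2 := (isRightDivisor_iff.1 (h'.2 τ h.1)).2
  exact Subtype.ext (braidIncl_injOn hn τ.2 τ'.2
    ((isGarside_braidDelta n).eq_of_dvd_dvd h1 h2))

/-! ### The splitting -/

/-- The tail condition of `IsSplitting`, at every entry of the list. -/
def HasTails (n : ℕ) (s : List (dualBraidMonoid (n - 1))) : Prop :=
  ∀ (u v : List (dualBraidMonoid (n - 1))) (x : dualBraidMonoid (n - 1)),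
    s = u ++ x :: v → IsTail n (rotProd n (u ++ [x])) x

theorem rotProd_concat (n : ℕ) (s : List (dualBraidMonoid (n - 1)))
    (x : dualBraidMonoid (n - 1)) :
    rotProd n (s ++ [x]) = rotAut n (rotProd n s) * braidIncl n x := by
  induction s with
  | nil => simp [rotProd]
  | cons y s ih =>
    rw [List.cons_append, rotProd, ih, rotProd, map_mul, List.length_append, List.length_singleton,
      pow_succ', MulAut.mul_apply, mul_assoc]

theorem rotProd_mem {n : ℕ} (s : List (dualBraidMonoid (n - 1))) :
    rotProd n s ∈ dualBraidMonoid n := by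
  induction s using List.reverseRecOn with
  | nil => exact one_mem _
  | append_singleton s x ih =>
    rw [rotProd_concat]; exact mul_mem (rotAut_mem ih) (braidIncl_mem x.2)

theorem hasTails_nil (n : ℕ) : HasTails n [] := fun u v x h => by simp at h

theorem hasTails_concat_iff {n : ℕ} {s : List (dualBraidMonoid (n - 1))}
    {x : dualBraidMonoid (n - 1)} :
    HasTails n (s ++ [x]) ↔ HasTails n s ∧ IsTail n (rotProd n (s ++ [x])) x := by
  constructor
  · refine fun h => ⟨fun u v y e => h u (v ++ [x]) y (by rw [e]; simp), h s [] x rfl⟩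
  · rintro ⟨h1, h2⟩ u v y e
    rcases List.eq_nil_or_concat v with rfl | ⟨v, z, rfl⟩
    · obtain ⟨rfl, e2⟩ := List.append_inj' e rfl
      obtain rfl : x = y := by simpa using e2
      exact h2
    · rw [List.concat_eq_append, ← List.cons_append, ← List.append_assoc] at e
      exact h1 u v y (List.append_inj' e rfl).1

theorem len_rotProd_pos {n : ℕ} {s : List (dualBraidMonoid (n - 1))} (hs : s ≠ [])
    (h : s.head hs ≠ 1) : 0 < len n (rotProd n s) := by
  induction s using List.reverseRecOn with
  | nil => exact absurd rfl hs
  | append_singleton s x ih =>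
    rw [rotProd_concat, len_mul, len_rotAut, len_braidIncl x.2]
    by_cases hs' : s = []
    · subst hs'
      have hx : (x : BraidGroup (n - 1)) ≠ 1 := fun e => h (by simpa using Subtype.ext e)
      have h0 := len_nonneg (rotProd_mem (n := n) [])
      have h1 := (len_nonneg x.2).lt_of_ne fun e => hx (eq_one_of_len_eq_zero x.2 e.symm)
      omega
    · have h0 := ih hs' (by rwa [List.head_append_of_ne_nil hs'] at h)
      have h1 := len_nonneg x.2
      omega

/-- A list with the tail condition and nontrivial head is determined by its product: its last
entry is the tail of the product, and the product is `1` only for the empty list. -/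
theorem eq_of_hasTails {n : ℕ} (hn : 1 ≤ n) {s t : List (dualBraidMonoid (n - 1))}
    (hs : HasTails n s) (ht : HasTails n t) (hs1 : ∀ h : s ≠ [], s.head h ≠ 1)
    (ht1 : ∀ h : t ≠ [], t.head h ≠ 1) (e : rotProd n s = rotProd n t) : s = t := by
  induction s using List.reverseRecOn generalizing t with
  | nil =>
    by_contra hne
    have := len_rotProd_pos (Ne.symm hne) (ht1 _)
    rw [← e, rotProd, len_one] at this
    exact lt_irrefl _ this
  | append_singleton s x ih =>
    rcases List.eq_nil_or_concat t with rfl | ⟨t, y, rfl⟩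
    · have := len_rotProd_pos (by simp) (hs1 (by simp))
      rw [e, rotProd, len_one] at this
      exact absurd this (lt_irrefl _)
    · rw [List.concat_eq_append] at ht ht1 e ⊢
      obtain ⟨hs', hx⟩ := hasTails_concat_iff.1 hs
      obtain ⟨ht', hy⟩ := hasTails_concat_iff.1 ht
      rw [e] at hx
      obtain rfl := isTail_unique hn hx hy
      rw [rotProd_concat, rotProd_concat] at e
      rw [ih hs' ht' (fun h => by
          have := hs1 (by simp); rwa [List.head_append_of_ne_nil h] at this)
        (fun h => by have := ht1 (by simp); rwa [List.head_append_of_ne_nil h] at this)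
        ((rotAut n).injective (mul_right_cancel e))]

/-- Every generator `a_{p,q}` is obtained by at most two rotations from a generator of
`B_{n-1}^{+*}`: some vertex of the `n`-gon avoids the chord. -/
theorem exists_rotAut_pow_eq {n : ℕ} (hn : 3 ≤ n) {p q : ℕ} (hp : 1 ≤ p) (hpq : p < q)
    (hq : q ≤ n) : ∃ k p' q', 1 ≤ p' ∧ p' < q' ∧ q' ≤ n - 1 ∧
      (rotAut n ^ k) (bklGen n p' q') = bklGen n p q := by
  rcases hq.lt_or_eq with h | rfl
  · exact ⟨0, p, q, hp, hpq, by omega, by simp⟩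
  · have e : ∀ p, 2 ≤ p → p < q → rotAut q (bklGen q (p - 1) (q - 1)) = bklGen q p q := by
      intro p h2 hpq
      rw [rotAut_bklGen_of_lt q (by omega) (by omega) (by omega), Nat.sub_add_cancel (by omega),
        Nat.sub_add_cancel (by omega)]
    by_cases h1 : p = 1
    · subst h1
      refine ⟨2, q - 2, q - 1, by omega, by omega, le_rfl, ?_⟩
      have := e (q - 1) (by omega) (by omega)
      rw [pow_two, MulAut.mul_apply, show q - 2 = q - 1 - 1 by omega, this,
        rotAut_bklGen_last q (by omega) (by omega), Nat.sub_add_cancel (by omega)]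
    · exact ⟨1, p - 1, q - 1, by omega, by omega, le_rfl, by rw [pow_one, e p (by omega) hpq]⟩

/-- The splitting, with the empty list for the trivial braid. -/
theorem exists_hasTails {n : ℕ} (hn : 3 ≤ n) {β : BraidGroup n} (hβ : β ∈ dualBraidMonoid n) :
    ∃ s : List (dualBraidMonoid (n - 1)), HasTails n s ∧ (∀ h : s ≠ [], s.head h ≠ 1) ∧
      β = rotProd n s := by
  obtain ⟨N, hN⟩ : ∃ N : ℕ, len n β < N := ⟨(len n β + 1).toNat, by omega⟩
  induction N generalizing β with
  | zero => have := len_nonneg hβ; simp at hN; omega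
  | succ N ihN =>
    -- some rotated generator of `B_{n-1}^{+*}` divides `β`; once its rotation exponent is used up,
    -- the tail is nontrivial and the length drops
    have inner : ∀ (k : ℕ) (β : BraidGroup n), β ∈ dualBraidMonoid n → len n β < (N + 1 : ℕ) →
        ∀ p q, 1 ≤ p → p < q → q ≤ n - 1 →
        β * ((rotAut n ^ k) (bklGen n p q))⁻¹ ∈ dualBraidMonoid n →
        ∃ s : List (dualBraidMonoid (n - 1)), HasTails n s ∧ (∀ h : s ≠ [], s.head h ≠ 1) ∧
          β = rotProd n s := by
      intro k
      induction k with
      | zero =>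
        intro β hβ hlen p q hp hpq hq hd
        rw [pow_zero, MulAut.one_apply] at hd
        obtain ⟨τ, hτ⟩ := exists_isTail (by omega : 1 ≤ n) hβ
        obtain ⟨hτM, hβτ⟩ := isRightDivisor_iff.1 hτ.1
        have hτ1 : 1 ≤ len n (braidIncl n τ) := by
          have hr := hτ.2 ⟨bklGen (n - 1) p q, bklGen_mem _ hp hpq hq⟩ (isRightDivisor_iff.2
            ⟨braidIncl_mem (bklGen_mem _ hp hpq hq), by rwa [braidIncl_bklGen hp hpq hq]⟩)
          rw [isRightDivisor_iff, braidIncl_bklGen hp hpq hq] at hr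
          have := len_nonneg hr.2
          rw [len_mul, len_inv, len_bklGen n hp hpq (by omega)] at this
          omega
        have hγ := rotAut_symm_mem hβτ
        have hlγ : len n ((rotAut n).symm (β * (braidIncl n τ)⁻¹)) < N := by
          rw [← len_rotAut, MulEquiv.apply_symm_apply, len_mul, len_inv]
          push_cast at hlen; omega
        obtain ⟨s, hs, hs1, e⟩ := ihN hγ hlγ
        have e' : β = rotProd n (s ++ [τ]) := by
          rw [rotProd_concat, ← e, MulEquiv.apply_symm_apply, inv_mul_cancel_right]
        refine ⟨s ++ [τ], hasTails_concat_iff.2 ⟨hs, e' ▸ hτ⟩, fun h => ?_, e'⟩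
        by_cases hs' : s = []
        · subst hs'
          intro h1
          have h1 : τ = 1 := by simpa using h1
          rw [h1] at hτ1
          simp at hτ1
        · rw [List.head_append_of_ne_nil hs']; exact hs1 hs'
      | succ k ihk =>
        intro β hβ hlen p q hp hpq hq hd
        obtain ⟨τ, hτ⟩ := exists_isTail (by omega : 1 ≤ n) hβ
        obtain ⟨hτM, hβτ⟩ := isRightDivisor_iff.1 hτ.1
        have hγ := rotAut_symm_mem hβτ
        have hlγ : len n ((rotAut n).symm (β * (braidIncl n τ)⁻¹)) =
            len n β - len n (braidIncl n τ) := by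
          rw [← len_rotAut, MulEquiv.apply_symm_apply, len_mul, len_inv]; ring
        by_cases hτ0 : braidIncl n τ = 1
        · rw [hτ0, inv_one, mul_one] at hγ hlγ
          rw [len_one, sub_zero] at hlγ
          obtain ⟨s, hs, hs1, e⟩ := ihk _ hγ (hlγ ▸ hlen) p q hp hpq hq (by
            have := rotAut_symm_mem hd
            rwa [map_mul, map_inv, pow_succ', MulAut.mul_apply, MulEquiv.symm_apply_apply] at this)
          have e' : β = rotProd n (s ++ [τ]) := by
            rw [rotProd_concat, ← e, MulEquiv.apply_symm_apply, hτ0, mul_one]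
          refine ⟨s ++ [τ], hasTails_concat_iff.2 ⟨hs, e' ▸ hτ⟩, fun h => ?_, e'⟩
          have hs' : s ≠ [] := by
            -- otherwise `β = 1`, which no generator divides
            rintro rfl
            rw [rotProd, ← map_one (rotAut n).symm] at e
            have hβ1 := (rotAut n).symm.injective e
            have h0 := len_nonneg hd
            have hpow : ∀ k, len n ((rotAut n ^ k) (bklGen n p q)) = 1 := by
              intro k
              induction k with
              | zero => simp [len_bklGen n hp hpq (by omega : q ≤ n)]
              | succ k ih => rw [pow_succ', MulAut.mul_apply, len_rotAut, ih]
            rw [hβ1, len_mul, len_one, len_inv, hpow] at h0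
            omega
          rw [List.head_append_of_ne_nil hs']; exact hs1 hs'
        · have hτ1 := (len_nonneg hτM).lt_of_ne fun h => hτ0 (eq_one_of_len_eq_zero hτM h.symm)
          obtain ⟨s, hs, hs1, e⟩ := ihN hγ (by rw [hlγ]; push_cast at hlen; omega)
          have e' : β = rotProd n (s ++ [τ]) := by
            rw [rotProd_concat, ← e, MulEquiv.apply_symm_apply, inv_mul_cancel_right]
          refine ⟨s ++ [τ], hasTails_concat_iff.2 ⟨hs, e' ▸ hτ⟩, fun h => ?_, e'⟩
          by_cases hs' : s = []
          · subst hs'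
            intro h1
            have h1 : τ = 1 := by simpa using h1
            exact hτ0 (by rw [h1]; simp)
          · rw [List.head_append_of_ne_nil hs']; exact hs1 hs'
    by_cases h1 : β = 1
    · exact ⟨[], hasTails_nil n, fun h => absurd rfl h, by rw [h1]; rfl⟩
    · obtain ⟨p, q, hp, hpq, hq, hd⟩ := exists_bklGen_mul hβ h1
      obtain ⟨k, p', q', hp', hpq', hq', e⟩ := exists_rotAut_pow_eq hn hp hpq hq
      exact inner k β hβ hN p' q' hp' hpq' hq' (by rwa [e])

theorem existsUnique_isSplitting {n : ℕ} (hn : 3 ≤ n) {β : BraidGroup n}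
    (hβ : β ∈ dualBraidMonoid n) (h1 : β ≠ 1) :
    ∃! s : List (dualBraidMonoid (n - 1)), IsSplitting n β s := by
  obtain ⟨s, hs, hs1, e⟩ := exists_hasTails hn hβ
  have hne : s ≠ [] := by rintro rfl; exact h1 e
  refine ⟨s, ⟨⟨hne, hs1 hne⟩, e, hs⟩, ?_⟩
  rintro t ⟨⟨htne, ht1⟩, e', ht⟩
  exact eq_of_hasTails (by omega) ht hs (fun _ => ht1) hs1 (e'.symm.trans e)

/-! ### The rotating normal form -/

theorem isBKLWord_map_rotLetter {n : ℕ} {w : BKLWord} (hw : IsBKLWord n w) (k : ℕ) :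
    IsBKLWord n (w.map ((rotLetter n)^[k])) ∧
      evalWord n (w.map ((rotLetter n)^[k])) = (rotAut n ^ k) (evalWord n w) := by
  have letters : ∀ l : ℕ × ℕ, 1 ≤ l.1 ∧ l.1 < l.2 ∧ l.2 ≤ n →
      (1 ≤ ((rotLetter n)^[k] l).1 ∧ ((rotLetter n)^[k] l).1 < ((rotLetter n)^[k] l).2 ∧
        ((rotLetter n)^[k] l).2 ≤ n) ∧
      bklGen n ((rotLetter n)^[k] l).1 ((rotLetter n)^[k] l).2 =
        (rotAut n ^ k) (bklGen n l.1 l.2) := by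
    intro l hl
    induction k with
    | zero => exact ⟨hl, rfl⟩
    | succ k ih =>
      rw [Function.iterate_succ_apply', pow_succ', MulAut.mul_apply, ← ih.2]
      exact rotLetter_spec n ih.1
  induction w with
  | nil => exact ⟨by simp [IsBKLWord], by simp⟩
  | cons l w ih =>
    obtain ⟨h1, h2⟩ := letters l (hw l (by simp))
    obtain ⟨h3, h4⟩ := ih fun l h => hw l (by simp [h])
    rw [List.map_cons, evalWord_cons, evalWord_cons, map_mul, h2, h4]
    exact ⟨List.forall_mem_cons.2 ⟨h1, h3⟩, rfl⟩

theorem evalWord_rotConcat {n : ℕ} {s : List (dualBraidMonoid (n - 1))} {ws : List BKLWord}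
    (h : List.Forall₂ (fun (x : dualBraidMonoid (n - 1)) (u : BKLWord) =>
      IsBKLWord (n - 1) u ∧ evalWord (n - 1) u = x) s ws) :
    IsBKLWord n (rotConcat n ws) ∧ evalWord n (rotConcat n ws) = rotProd n s := by
  induction h with
  | nil => exact ⟨by simp [rotConcat, IsBKLWord], rfl⟩
  | @cons x u s ws hxu hs ih =>
    obtain ⟨h1, h2⟩ := isBKLWord_map_rotLetter (isBKLWord_of_pred hxu.1) ws.length
    refine ⟨fun l hl => (List.mem_append.1 hl).elim (h1 l) (ih.1 l), ?_⟩
    rw [rotConcat, evalWord_append, h2, ih.2, rotProd, hs.length_eq, ← hxu.2,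
      braidIncl_evalWord hxu.1]

theorem existsUnique_forall₂ {α β : Type*} {R : α → β → Prop} {s : List α}
    (h : ∀ x ∈ s, ∃! u, R x u) : ∃! ws, List.Forall₂ R s ws := by
  induction s with
  | nil => exact ⟨[], List.Forall₂.nil, fun ws h => by cases h; rfl⟩
  | cons x s ih =>
    obtain ⟨u, hu, hu'⟩ := h x (by simp)
    obtain ⟨ws, hws, hws'⟩ := ih fun x hx => h x (by simp [hx])
    refine ⟨u :: ws, List.Forall₂.cons hu hws, fun ws' h' => ?_⟩
    cases h' with
    | cons h1 h2 => rw [hu' _ h1, hws' _ h2]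

theorem existsUnique_isRotatingNormalForm (n : ℕ) {β : BraidGroup (n + 2)}
    (hβ : β ∈ dualBraidMonoid (n + 2)) :
    (∃! w : BKLWord, IsRotatingNormalForm (n + 2) β w) ∧
      ∀ w : BKLWord, IsRotatingNormalForm (n + 2) β w →
        IsBKLWord (n + 2) w ∧ evalWord (n + 2) w = β := by
  induction n with
  | zero =>
    have hword : ∀ k, IsBKLWord 2 (List.replicate k (1, 2)) := by
      intro k l hl
      rw [List.eq_of_mem_replicate hl]; simp
    obtain ⟨w, hw, rfl⟩ := mem_dualBraidMonoid_iff.1 hβ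
    have hwk : w = List.replicate w.length (1, 2) := List.eq_replicate_of_mem fun l hl => by
      have := hw l hl
      exact Prod.ext (by dsimp only; omega) (by dsimp only; omega)
    refine ⟨⟨w, ⟨w.length, hwk, rfl⟩, ?_⟩, ?_⟩
    · rintro _ ⟨k, rfl, e⟩
      have := congrArg (len 2) e
      rw [len_evalWord 2 hw, len_evalWord 2 (hword k), List.length_replicate] at this
      rw [hwk]; congr 1; exact_mod_cast this.symm
    · rintro _ ⟨k, rfl, e⟩
      exact ⟨hword k, e.symm⟩
  | succ n ih =>
    by_cases h1 : β = 1
    · refine ⟨⟨[], Or.inl ⟨h1, rfl⟩, ?_⟩, ?_⟩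
      · rintro w (⟨-, rfl⟩ | ⟨h, -⟩)
        · rfl
        · exact absurd h1 h
      · rintro w (⟨-, rfl⟩ | ⟨h, -⟩)
        · exact ⟨by simp [IsBKLWord], h1.symm⟩
        · exact absurd h1 h
    · obtain ⟨s, hs, hsu⟩ := existsUnique_isSplitting (by omega : 3 ≤ n + 3) hβ h1
      obtain ⟨ws, hws, hwsu⟩ := existsUnique_forall₂ (R := fun (x : dualBraidMonoid (n + 2))
        (u : BKLWord) => IsRotatingNormalForm (n + 2) (x : BraidGroup (n + 2)) u) (s := s)
        fun x _ => (ih x.2).1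
      refine ⟨⟨rotConcat (n + 3) ws, Or.inr ⟨h1, s, ws, hs, hws, rfl⟩, ?_⟩, ?_⟩
      · rintro w (⟨h, -⟩ | ⟨-, s', ws', hs', hws', rfl⟩)
        · exact absurd h h1
        · obtain rfl := hsu s' hs'
          rw [hwsu ws' hws']
      · rintro w (⟨h, -⟩ | ⟨-, s', ws', hs', hws', rfl⟩)
        · exact absurd h h1
        · have := evalWord_rotConcat (n := n + 3) (hws'.imp fun x u hxu => (ih x.2).2 u hxu)
          exact ⟨this.1, this.2.trans hs'.2.1.symm⟩

end DualBraid


theorem proposition2p5 (n : ℕ) (hn : 3 ≤ n) :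
    (∀ β ∈ dualBraidMonoid n, β ≠ 1 →
      ∃! s : List (dualBraidMonoid (n - 1)), IsSplitting n β s) ∧
    (∀ β ∈ dualBraidMonoid n,
      (∃! w : BKLWord, IsRotatingNormalForm n β w) ∧
      ∀ w : BKLWord, IsRotatingNormalForm n β w → IsBKLWord n w ∧ evalWord n w = β) := by
  obtain ⟨m, rfl⟩ : ∃ m, n = m + 2 := ⟨n - 2, by omega⟩
  exact ⟨fun β hβ h1 => DualBraid.existsUnique_isSplitting hn hβ h1,
    fun β hβ => DualBraid.existsUnique_isRotatingNormalForm m hβ⟩
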